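/- All matrices are complex. A pencil $A-\lambda B$ is a pair $(A,B)$ of matrices of equal size, and its normal rank is $\operatorname{nrank}(A,B)=\max_{\zeta\in\mathbb C}\operatorname{rank}(A-\zeta B)$. A number $\lambda_0\in\mathbb C$ is an eigenvalue of the pencil if $\operatorname{rank}(A-\lambda_0B)<\operatorname{nrank}(A,B)$, and $\infty$ is an eigenvalue if $\operatorname{rank}(B)<\operatorname{nrank}(A,B)$. A square pencil is singular if $\det(A-\lambda B)\equiv0$ and regular otherwise. Two pencils are strictly equivalent if $P(A-\lambda B)Q=A'-\lambda B'$ for some constant nonsingular $P,Q$. For $j\ge 0$ let $L_j(\lambda)=[\,0\ \ I_j\,]-\lambda[\,I_j\ \ 0\,]$, of size $j\times(j+1)$. A regular part of a pencil is a regular pencil $R(\lambda)$ (possibly of size $0$) such that the pencil is strictly equivalent to $\operatorname{diag}(R(\lambda),S(\lambda))$ with $S(\lambda)=\operatorname{diag}(L_{m_1}(\lambda),\dots,L_{m_p}(\lambda),L_{n_1}(\lambda)^\top,\dots,L_{n_q}(\lambda)^\top)$ for some $p,q\ge 0$ and $m_i,n_j\ge0$. A property of pairs $(U,V)\in(\mathbb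 C^{n,k})^2$ holds generically with respect to the entries of $U$ and $V^*$ if there is a proper subset of $\mathbb C^{2nk}$, the common zero set of finitely many complex polynomials, such that the property holds for all $(U,V)$ for which the point formed by the entries of $U$ and $V^*$ lies outside this set. **Theorem.** Let $A-\lambda B$ be an $n\times n$ singular pencil of normal rank $n-k$, and let $D_A,D_B\in\mathbb C^{k,k}$ be such that $D_A-\lambda D_B$ is regular and no eigenvalue (finite or infinite) of $D_A-\lambda D_B$ is an eigenvalue of $A-\lambda B$. Then $A-\lambda B$ has a regular part, and for every regular part $R(\lambda)$ of $A-\lambda B$ the following holds generically with respect to the entries of $U$ and $V^*$, for $U,V\in\mathbb C^{n,k}$ of full column rank. Write $$\widetilde A_\tau-\lambda\widetilde B_\tau=A-\lambda B+\tau\,(UD_AV^*-\lambda\,UD_BV^*),\qquad \tau\in\mathbb C .$$ 1. For each $\tau\ne0$ the pencil $\widetilde A_\tau-\lambda\widetilde B_\tau$ is strictly equivalent to $\operatorname{diag}(R(\lambda),R_{\rm new}(\lambda))$ for some regular pencil $R_{\rm new}(\lambda)$ (which may depend on $\tau$) that has no eigenvalue, finite or infinite, in common with $R(\lambda)$. 2.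 Let $\lambda_0\in\mathbb C$ be a finite eigenvalue of $A-\lambda B$. Then $\lambda_0$ is an eigenvalue of $\widetilde A_\tau-\lambda\widetilde B_\tau$ for each $\tau\neq0$; the null spaces $\ker(\widetilde A_\tau-\lambda_0\widetilde B_\tau)$ and $\ker((\widetilde A_\tau-\lambda_0\widetilde B_\tau)^*)$ are the same for all $\tau\ne0$; and for every $\tau\ne 0$, $V^*x=0$ for each $x$ in the former and $U^*y=0$ for each $y$ in the latter. 3. If $\infty$ is an eigenvalue of $A-\lambda B$, then $\infty$ is an eigenvalue of $\widetilde A_\tau-\lambda\widetilde B_\tau$ for each $\tau\neq0$; the null spaces $\ker(\widetilde B_\tau)$ and $\ker(\widetilde B_\tau^*)$ are the same for all $\tau\ne0$; and for every $\tau\ne 0$, $V^*x=0$ for each $x$ in the former and $U^*y=0$ for each $y$ in the latter. -/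

import Mathlib

/-- A matrix pencil `A - lambda B` with complex coefficients. -/
@[ext]
structure MatrixPencil (m n : Type) where
  /-- the constant coefficient -/
  A : Matrix m n ℂ
  /-- minus the coefficient of `lambda` -/
  B : Matrix m n ℂ

namespace MatrixPencil

/-- The value of the pencil at a point of the extended complex plane: `A - z B` at a finite `z`,
and `B` at infinity. -/
noncomputable def valueAt {m n : Type} (K : MatrixPencil m n) (z : OnePoint ℂ) : Matrix m n ℂ :=
  OnePoint.elim z K.B fun w : ℂ => K.A - w • K.B

/-- The normal rank: the maximum over finite `z` of the rank of `A - z B`. (The set of these ranks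
is non-empty and bounded by the number of columns.) -/
noncomputable def nrank {m n : Type} [Fintype n] (K : MatrixPencil m n) : ℕ :=
  ⨆ z : ℂ, (K.A - z • K.B).rank

/-- `z`, finite or infinite, is an eigenvalue if the rank drops there below the normal rank. -/
def IsEigenvalue {m n : Type} [Fintype n] (K : MatrixPencil m n) (z : OnePoint ℂ) : Prop :=
  (K.valueAt z).rank < K.nrank

/-- A square pencil is singular if `det (A - z B)` vanishes identically. -/
def IsSingular {n : Type} [Fintype n] [DecidableEq n] (K : MatrixPencil n n) : Prop :=
  ∀ z : ℂ, (K.A - z • K.B).det = 0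

/-- A square pencil is regular if `det (A - z B)` does not vanish identically. -/
def IsRegular {n : Type} [Fintype n] [DecidableEq n] (K : MatrixPencil n n) : Prop :=
  ∃ z : ℂ, (K.A - z • K.B).det ≠ 0

/-- The block diagonal pencil `diag(K, L)`. -/
def directSum {m n m' n' : Type} (K : MatrixPencil m n) (L : MatrixPencil m' n') :
    MatrixPencil (m ⊕ m') (n ⊕ n') where
  A := Matrix.fromBlocks K.A 0 0 L.A
  B := Matrix.fromBlocks K.B 0 0 L.B

/-- The transposed pencil `A^T - lambda B^T`. -/
def transpose {m n : Type} (K : MatrixPencil m n) : MatrixPencil n m where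
  A := K.A.transpose
  B := K.B.transpose

/-- The block diagonal pencil with an arbitrary finite family of blocks. -/
def blockDiag {ι : Type} [DecidableEq ι] {m n : ι → Type}
    (K : (i : ι) → MatrixPencil (m i) (n i)) : MatrixPencil (Σ i, m i) (Σ i, n i) where
  A := Matrix.blockDiagonal' fun i => (K i).A
  B := Matrix.blockDiagonal' fun i => (K i).B

/-- The Kronecker block `L_j = [0 I_j] - lambda [I_j 0]`, of size `j × (j+1)`, where `j = 0` is
allowed. -/
def kroneckerBlock (j : ℕ) : MatrixPencil (Fin j) (Fin (j + 1)) where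
  A := Matrix.of fun i c => if c = i.succ then 1 else 0
  B := Matrix.of fun i c => if c = i.castSucc then 1 else 0

/-- The singular pencil in Kronecker form with right minimal indices `ε` and left minimal
indices `η`, that is `diag(L_{ε 1}, ..., L_{ε p}, L_{η 1}^T, ..., L_{η q}^T)`. -/
def kroneckerSingular {p q : ℕ} (ε : Fin p → ℕ) (η : Fin q → ℕ) :
    MatrixPencil ((Σ i, Fin (ε i)) ⊕ (Σ j, Fin (η j + 1)))
      ((Σ i, Fin (ε i + 1)) ⊕ (Σ j, Fin (η j))) :=
  directSum (blockDiag fun i => kroneckerBlock (ε i))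
    (blockDiag fun j => (kroneckerBlock (η j)).transpose)

/-- Strict equivalence `P (A - lambda B) Q = A' - lambda B'` with `P`, `Q` nonsingular. The row and
column index types of the two pencils may differ, so nonsingularity of `P` and `Q` is expressed by
two-sided inverses. -/
def StrictlyEquivalent {m n m' n' : Type} [Fintype m] [Fintype n] [Fintype m'] [Fintype n']
    [DecidableEq m] [DecidableEq n] [DecidableEq m'] [DecidableEq n']
    (K : MatrixPencil m n) (L : MatrixPencil m' n') : Prop :=
  ∃ (P : Matrix m' m ℂ) (P' : Matrix m m' ℂ) (Q : Matrix n n' ℂ) (Q' : Matrix n' n ℂ),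
    P * P' = 1 ∧ P' * P = 1 ∧ Q * Q' = 1 ∧ Q' * Q = 1 ∧ P * K.A * Q = L.A ∧ P * K.B * Q = L.B

/-- `R` is the regular part of `K`: it is regular, and `K` is strictly equivalent to `diag(R, S)`
with `S` a direct sum of Kronecker blocks and transposed Kronecker blocks. This determines `R` up
to strict equivalence; the Jordan normalised regular part of the Kronecker canonical form is one
such `R`. -/
def IsRegularPart {m n : Type} [Fintype m] [Fintype n] [DecidableEq m] [DecidableEq n]
    (K : MatrixPencil m n) {r : ℕ} (R : MatrixPencil (Fin r) (Fin r)) : Prop :=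
  R.IsRegular ∧ ∃ (p q : ℕ) (ε : Fin p → ℕ) (η : Fin q → ℕ),
    K.StrictlyEquivalent (R.directSum (kroneckerSingular ε η))

/-- The perturbed pencil `A - lambda B + tau U (D_A - lambda D_B) V^*`. -/
noncomputable def perturb {m n k : Type} [Fintype k] (K : MatrixPencil m n)
    (U : Matrix m k ℂ) (V : Matrix n k ℂ) (D : MatrixPencil k k) (τ : ℂ) : MatrixPencil m n where
  A := K.A + τ • (U * D.A * V.conjTranspose)
  B := K.B + τ • (U * D.B * V.conjTranspose)

/-- The right null space of the pencil at `z`, the kernel of `A - z B`, or of `B` if `z = ∞`. -/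
noncomputable def rightNull {m n : Type} [Fintype n] (K : MatrixPencil m n) (z : OnePoint ℂ) :
    Submodule ℂ (n → ℂ) :=
  LinearMap.ker (K.valueAt z).mulVecLin

/-- The left null space of the pencil at `z`, the kernel of `(A - z B)^*`, or of `B^*` if
`z = ∞`. -/
noncomputable def leftNull {m n : Type} [Fintype m] (K : MatrixPencil m n) (z : OnePoint ℂ) :
    Submodule ℂ (m → ℂ) :=
  LinearMap.ker (K.valueAt z).conjTranspose.mulVecLin

end MatrixPencil

/-- A set of common zeros of finitely many complex polynomials. -/
def IsAlgebraicSet {σ : Type} (S : Set (σ → ℂ)) : Prop :=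
  ∃ F : Finset (MvPolynomial σ ℂ), S = {x | ∀ f ∈ F, MvPolynomial.eval x f = 0}

/-- A set whose complement is contained in a proper algebraic set. -/
def IsGenericSet {σ : Type} (Ω : Set (σ → ℂ)) : Prop :=
  ∃ S : Set (σ → ℂ), IsAlgebraicSet S ∧ S ≠ Set.univ ∧ Ωᶜ ⊆ S

/-- The entries of the pair `(U, W)`, as a point of the affine space with one coordinate for every
entry. -/
def pairEntries {n k : ℕ} (U : Matrix (Fin n) (Fin k) ℂ) (W : Matrix (Fin k) (Fin n) ℂ) :
    (Fin n × Fin k) ⊕ (Fin k × Fin n) → ℂ :=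
  Sum.elim (fun p => U p.1 p.2) (fun p => W p.1 p.2)

/-- A property of `(U, V)` holds generically with respect to the entries of `U` and `V^*`. -/
def HoldsGenerically {n k : ℕ}
    (P : Matrix (Fin n) (Fin k) ℂ → Matrix (Fin n) (Fin k) ℂ → Prop) : Prop :=
  ∃ Ω : Set ((Fin n × Fin k) ⊕ (Fin k × Fin n) → ℂ), IsGenericSet Ω ∧
    ∀ U V : Matrix (Fin n) (Fin k) ℂ, pairEntries U V.conjTranspose ∈ Ω → P U V

open Matrix

namespace MatrixPencil

/-! ### Strict equivalence -/

namespace StrictlyEquivalent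

variable {m n m' n' m'' n'' a b a' b' : Type} [Fintype m] [Fintype n] [Fintype m'] [Fintype n']
  [Fintype m''] [Fintype n''] [DecidableEq m] [DecidableEq n] [DecidableEq m'] [DecidableEq n']
  [DecidableEq m''] [DecidableEq n''] [Fintype a] [Fintype b] [Fintype a'] [Fintype b']
  [DecidableEq a] [DecidableEq b] [DecidableEq a'] [DecidableEq b']

/-! Kronecker's theorem supplies the form `diag(R, S)`. A polynomial null vector of minimal degree
`e` has coefficients that span a copy of `L_e`. Minimality provides functionals dual to them, and
these make the copy a direct summand (`IsNullChain.exists_directSum`). Left null vectors are treated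
by transposition. A pencil with neither kind of null vector is square with nonzero determinant
polynomial.

The singular part `S` has the same rank at every point of the projective line. Hence the eigenvalues
of the pencil are those of `R`, and counting rows and columns gives exactly `k` blocks of each kind.

The regular part survives the perturbation because of `exists_deflation`. In Kronecker coordinates,
the space on which `R` acts can be tilted into the singular summand, as the columns of `(1, X, 0)`,
so that it remains deflating with action `R` and is annihilated by `V^*`. The admissible `X` arise
by substituting a commuting pair of matrices built from `R` into the polynomial null vectors of the
blocks `L_j`. Annihilation is then a linear system over a commutative matrix algebra, solvable as
soon as `V^*` is injective on the null vectors of `S` at every eigenvalue of `R`. The transposed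
argument tilts the left space into the kernel of `U`. Neither tilt involves `τ`, `D_A` or `D_B`, so
one transformation splits off `R` from every perturbation.

The rest is rank counting. At a point `z` where `D(z)` is invertible and `U`, `V^*` pair
nondegenerately with `k` left and `k` right null vectors, the perturbation raises the rank by `k`,
and its kernel is that of the original pencil intersected with `ker V^*` (`rank_add_smul`). The
complement of `R` is therefore invertible at each eigenvalue of `R`, and at an auxiliary point `μ`,
which makes it regular. All conditions on `(U, V)` are finitely many nonvanishing determinants. -/

theorem trans {K : MatrixPencil m n} {L : MatrixPencil m' n'} {M : MatrixPencil m'' n''}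
    (h : K.StrictlyEquivalent L) (h' : L.StrictlyEquivalent M) : K.StrictlyEquivalent M := by
  obtain ⟨P, P', Q, Q', h1, h2, h3, h4, h5, h6⟩ := h
  obtain ⟨S, S', T, T', k1, k2, k3, k4, k5, k6⟩ := h'
  refine ⟨S * P, P' * S', Q * T, T' * Q', ?_, ?_, ?_, ?_, ?_, ?_⟩
  · rw [Matrix.mul_assoc, ← Matrix.mul_assoc P, h1, Matrix.one_mul, k1]
  · rw [Matrix.mul_assoc, ← Matrix.mul_assoc S', k2, Matrix.one_mul, h2]
  · rw [Matrix.mul_assoc, ← Matrix.mul_assoc T, k3, Matrix.one_mul, h3]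
  · rw [Matrix.mul_assoc, ← Matrix.mul_assoc Q', h4, Matrix.one_mul, k4]
  · rw [← k5, ← h5]; simp only [Matrix.mul_assoc]
  · rw [← k6, ← h6]; simp only [Matrix.mul_assoc]

theorem of_equiv (K : MatrixPencil m n) (L : MatrixPencil m' n') (e : m' ≃ m) (f : n' ≃ n)
    (hA : K.A.submatrix e f = L.A) (hB : K.B.submatrix e f = L.B) : K.StrictlyEquivalent L := by
  have key (M : Matrix m n ℂ) : (1 : Matrix m m ℂ).submatrix e id * M *
      (1 : Matrix n n ℂ).submatrix id f = M.submatrix e f := by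
    ext i j
    simp [Matrix.mul_apply, Matrix.one_apply]
  refine ⟨(1 : Matrix m m ℂ).submatrix e id, (1 : Matrix m m ℂ).submatrix id e,
    (1 : Matrix n n ℂ).submatrix id f, (1 : Matrix n n ℂ).submatrix f id, ?_, ?_, ?_, ?_,
    (key _).trans hA, (key _).trans hB⟩
  · ext i j; simp [Matrix.mul_apply, Matrix.one_apply]
  · ext i j
    simp only [Matrix.mul_apply, submatrix_apply, id, Matrix.one_apply]
    rw [Equiv.sum_comp e (fun x => (if i = x then (1 : ℂ) else 0) * if x = j then 1 else 0)]
    simp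
  · ext i j
    simp only [Matrix.mul_apply, submatrix_apply, id, Matrix.one_apply]
    rw [Equiv.sum_comp f (fun x => (if i = x then (1 : ℂ) else 0) * if x = j then 1 else 0)]
    simp
  · ext i j; simp [Matrix.mul_apply, Matrix.one_apply]

theorem refl (K : MatrixPencil m n) : K.StrictlyEquivalent K :=
  of_equiv K K (Equiv.refl _) (Equiv.refl _) rfl rfl

theorem transpose {K : MatrixPencil m n} {L : MatrixPencil m' n'} (h : K.StrictlyEquivalent L) :
    K.transpose.StrictlyEquivalent L.transpose := by
  obtain ⟨P, P', Q, Q', h1, h2, h3, h4, h5, h6⟩ := h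
  refine ⟨Qᵀ, Q'ᵀ, Pᵀ, P'ᵀ, ?_, ?_, ?_, ?_, ?_, ?_⟩
  · rw [← transpose_mul, h4, transpose_one]
  · rw [← transpose_mul, h3, transpose_one]
  · rw [← transpose_mul, h2, transpose_one]
  · rw [← transpose_mul, h1, transpose_one]
  · simp only [MatrixPencil.transpose, ← h5, transpose_mul, Matrix.mul_assoc]
  · simp only [MatrixPencil.transpose, ← h6, transpose_mul, Matrix.mul_assoc]

theorem directSum {K : MatrixPencil m n} {L : MatrixPencil m' n'} {K' : MatrixPencil a b}
    {L' : MatrixPencil a' b'} (h : K.StrictlyEquivalent L) (h' : K'.StrictlyEquivalent L') :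
    (K.directSum K').StrictlyEquivalent (L.directSum L') := by
  obtain ⟨P, P', Q, Q', h1, h2, h3, h4, h5, h6⟩ := h
  obtain ⟨S, S', T, T', k1, k2, k3, k4, k5, k6⟩ := h'
  refine ⟨fromBlocks P 0 0 S, fromBlocks P' 0 0 S', fromBlocks Q 0 0 T, fromBlocks Q' 0 0 T',
    ?_, ?_, ?_, ?_, ?_, ?_⟩ <;>
  simp [MatrixPencil.directSum, fromBlocks_multiply, *]

end StrictlyEquivalent

/-! ### Direct summands from retractions -/

/-- A left inverse of a matrix extends to a decomposition of the space into two summands. -/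
theorem exists_complement {n a : Type} [Fintype n] [DecidableEq n] [Fintype a] [DecidableEq a]
    (i : Matrix n a ℂ) (f : Matrix a n ℂ) (hf : f * i = 1) :
    ∃ (c : ℕ) (i' : Matrix n (Fin c) ℂ) (f' : Matrix (Fin c) n ℂ),
      f' * i' = 1 ∧ f' * i = 0 ∧ f * i' = 0 ∧ i * f + i' * f' = 1 ∧
        c + Fintype.card a = Fintype.card n := by
  -- The complement of the range of `i` is `ker f`, with projection `1 - i * f`.
  set E := LinearMap.ker f.mulVecLin with hE
  let b := Module.finBasis ℂ E
  let p : (n → ℂ) →ₗ[ℂ] E := LinearMap.codRestrict E (1 - i * f).mulVecLin (by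
    intro x
    rw [hE, LinearMap.mem_ker, mulVecLin_apply, mulVecLin_apply, mulVec_mulVec, Matrix.mul_sub,
      ← Matrix.mul_assoc, hf]
    simp)
  have tm {c d : Type} [Fintype d] [DecidableEq d] (M : Matrix c d ℂ) :
      LinearMap.toMatrix' M.mulVecLin = M := LinearMap.toMatrix'_toLin' M
  have hp (x : E) : p x = x := by
    apply Subtype.ext
    have hx : f *ᵥ (x : n → ℂ) = 0 := x.2
    change (1 - i * f) *ᵥ (x : n → ℂ) = x
    rw [sub_mulVec, ← mulVec_mulVec, hx, mulVec_zero, one_mulVec, sub_zero]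
  let I : (Fin (Module.finrank ℂ E) → ℂ) →ₗ[ℂ] n → ℂ := E.subtype ∘ₗ b.equivFun.symm.toLinearMap
  let F : (n → ℂ) →ₗ[ℂ] Fin (Module.finrank ℂ E) → ℂ := b.equivFun.toLinearMap ∘ₗ p
  refine ⟨_, LinearMap.toMatrix' I, LinearMap.toMatrix' F, ?_, ?_, ?_, ?_, ?_⟩
  · rw [← LinearMap.toMatrix'_comp, ← LinearMap.toMatrix'_id]
    refine congrArg _ (LinearMap.ext fun x => ?_)
    change b.equivFun (p (b.equivFun.symm x : E)) = x
    rw [hp, LinearEquiv.apply_symm_apply]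
  · have h : F ∘ₗ i.mulVecLin = 0 := by
      refine LinearMap.ext fun x => ?_
      have : p (i *ᵥ x) = 0 := by
        apply Subtype.ext
        change (1 - i * f) *ᵥ (i *ᵥ x) = 0
        rw [mulVec_mulVec, Matrix.sub_mul, Matrix.mul_assoc, hf, Matrix.one_mul, Matrix.mul_one,
          sub_self, zero_mulVec]
      simp [F, this]
    have := congrArg LinearMap.toMatrix' h
    rwa [LinearMap.toMatrix'_comp, tm, map_zero] at this
  · have h : f.mulVecLin ∘ₗ I = 0 := by
      refine LinearMap.ext fun x => ?_
      exact (b.equivFun.symm x).2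
    have := congrArg LinearMap.toMatrix' h
    rwa [LinearMap.toMatrix'_comp, tm, map_zero] at this
  · have h : I ∘ₗ F = (1 - i * f).mulVecLin := by
      refine LinearMap.ext fun x => ?_
      simp [I, F, p]
    have := congrArg LinearMap.toMatrix' h
    rw [LinearMap.toMatrix'_comp, tm] at this
    rw [this]; abel
  · have hs : Function.Surjective f.mulVecLin := fun x =>
      ⟨i *ᵥ x, by rw [mulVecLin_apply, mulVec_mulVec, hf, one_mulVec]⟩
    have := f.mulVecLin.finrank_range_add_finrank_ker
    rw [LinearMap.range_eq_top.2 hs, finrank_top, Module.finrank_fintype_fun_eq_card,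
      Module.finrank_fintype_fun_eq_card, ← hE] at this
    omega

/-- A pencil with a retraction onto a pencil `L` has `L` as a direct summand. -/
theorem exists_directSum_of_retraction {m n a b : Type} [Fintype m] [Fintype n] [Fintype a]
    [Fintype b] [DecidableEq m] [DecidableEq n] [DecidableEq a] [DecidableEq b]
    (K : MatrixPencil m n) (L : MatrixPencil a b) (i : Matrix n b ℂ) (f : Matrix b n ℂ)
    (j : Matrix m a ℂ) (g : Matrix a m ℂ) (hf : f * i = 1) (hg : g * j = 1)
    (hA : K.A * i = j * L.A) (hB : K.B * i = j * L.B) (hA' : g * K.A = L.A * f)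
    (hB' : g * K.B = L.B * f) :
    ∃ (c d : ℕ) (K' : MatrixPencil (Fin c) (Fin d)), c + Fintype.card a = Fintype.card m ∧
      d + Fintype.card b = Fintype.card n ∧ K.StrictlyEquivalent (L.directSum K') := by
  obtain ⟨d, i', f', h1, h2, h3, h4, h5⟩ := exists_complement i f hf
  obtain ⟨c, j', g', k1, k2, k3, k4, k5⟩ := exists_complement j g hg
  -- The relation with `i`, `j` kills one off-diagonal block, and the one with `f`, `g` kills the
  -- other.
  have key (M : Matrix m n ℂ) (N : Matrix a b ℂ) (h : M * i = j * N) (h' : g * M = N * f) :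
      fromRows g g' * M * fromCols i i' = fromBlocks N 0 0 (g' * M * i') := by
    rw [fromRows_mul, fromRows_mul_fromCols, h', Matrix.mul_assoc N, hf, Matrix.mul_one,
      Matrix.mul_assoc N, h3, Matrix.mul_zero, Matrix.mul_assoc g', h, ← Matrix.mul_assoc, k2,
      Matrix.zero_mul]
  refine ⟨c, d, ⟨g' * K.A * i', g' * K.B * i'⟩, k5, h5, fromRows g g', fromCols j j',
    fromCols i i', fromRows f f', ?_, ?_, ?_, ?_, key _ _ hA hA', key _ _ hB hB'⟩
  · rw [fromRows_mul_fromCols, hg, k1, k2, k3, fromBlocks_one]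
  · rw [fromCols_mul_fromRows, k4]
  · rw [fromCols_mul_fromRows, h4]
  · rw [fromRows_mul_fromCols, hf, h1, h2, h3, fromBlocks_one]

/-! ### Splitting off a Kronecker block -/

/-- The coefficient sequence of a polynomial null vector of degree at most `e`. -/
structure IsNullChain {m n : Type} [Fintype n] (K : MatrixPencil m n) (e : ℕ) (x : ℕ → n → ℂ) :
    Prop where
  zero : K.A *ᵥ x 0 = 0
  succ : ∀ i, K.A *ᵥ x (i + 1) = K.B *ᵥ x i
  eq_zero : ∀ i, e < i → x i = 0

theorem mul_kroneckerBlock_A_zero {m : Type} {e : ℕ} (M : Matrix m (Fin e) ℂ) (r : m) :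
    (M * (kroneckerBlock e).A) r 0 = 0 := by
  simp [Matrix.mul_apply, kroneckerBlock, (Fin.succ_ne_zero _).symm]

theorem mul_kroneckerBlock_A_succ {m : Type} {e : ℕ} (M : Matrix m (Fin e) ℂ) (r : m)
    (c : Fin e) : (M * (kroneckerBlock e).A) r c.succ = M r c := by
  simp [Matrix.mul_apply, kroneckerBlock]

theorem mul_kroneckerBlock_B_last {m : Type} {e : ℕ} (M : Matrix m (Fin e) ℂ) (r : m) :
    (M * (kroneckerBlock e).B) r (Fin.last e) = 0 := by
  simp [Matrix.mul_apply, kroneckerBlock, (Fin.castSucc_ne_last _).symm]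

theorem mul_kroneckerBlock_B_castSucc {m : Type} {e : ℕ} (M : Matrix m (Fin e) ℂ) (r : m)
    (c : Fin e) : (M * (kroneckerBlock e).B) r c.castSucc = M r c := by
  simp [Matrix.mul_apply, kroneckerBlock]

theorem kroneckerBlock_A_mul {n : Type} {e : ℕ} (M : Matrix (Fin (e + 1)) n ℂ) (r : Fin e)
    (c : n) : ((kroneckerBlock e).A * M) r c = M r.succ c := by
  simp [Matrix.mul_apply, kroneckerBlock]

theorem kroneckerBlock_B_mul {n : Type} {e : ℕ} (M : Matrix (Fin (e + 1)) n ℂ) (r : Fin e)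
    (c : n) : ((kroneckerBlock e).B * M) r c = M r.castSucc c := by
  simp [Matrix.mul_apply, kroneckerBlock]

section Chain

variable {m n : Type} [Fintype m] [Fintype n] [DecidableEq m] [DecidableEq n]
  {K : MatrixPencil m n} {e : ℕ} {x : ℕ → n → ℂ}

/-- Functionals that separate a null chain of minimal length. -/
theorem IsNullChain.exists_functionals (hx : K.IsNullChain (e + 1) x) (h0 : x 0 ≠ 0)
    (hmin : ∀ y, K.IsNullChain e y → y = 0) :
    ∃ g : ℕ → m → ℂ, (∀ j < e, g j ᵥ* K.A = g (j + 1) ᵥ* K.B) ∧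
      ∀ i, ∀ j ≤ e, g j ⬝ᵥ K.B *ᵥ x i = if j = i then 1 else 0 := by
  -- The coefficient sequences of `(A - λB) v(λ)` for polynomial vectors `v` of degree less than
  -- `e`.
  let S : Submodule ℂ (ℕ → m → ℂ) :=
    { carrier := {u | ∃ v : ℕ → n → ℂ, (∀ i, e ≤ i → v i = 0) ∧ u 0 = K.A *ᵥ v 0 ∧
        ∀ i, u (i + 1) = K.A *ᵥ v (i + 1) - K.B *ᵥ v i}
      zero_mem' := ⟨0, by simp⟩
      add_mem' := by
        rintro u u' ⟨v, h1, h2, h3⟩ ⟨v', h1', h2', h3'⟩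
        refine ⟨v + v', fun i hi => by simp [h1 i hi, h1' i hi], by simp [h2, h2', mulVec_add],
          fun i => ?_⟩
        simp only [Pi.add_apply, h3, h3', mulVec_add]; abel
      smul_mem' := by
        rintro c u ⟨v, h1, h2, h3⟩
        refine ⟨c • v, fun i hi => by simp [h1 i hi], by simp [h2, mulVec_smul], fun i => ?_⟩
        simp only [Pi.smul_apply, h3, mulVec_smul, smul_sub] }
  -- Otherwise prepending `x 0` to `v` would give a nonzero null chain of degree at most `e`.
  have hS : (Pi.single 0 (K.B *ᵥ x 0) : ℕ → m → ℂ) ∉ S := by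
    rintro ⟨v, h1, h2, h3⟩
    refine h0 (congrFun (hmin (fun i => Nat.casesOn i (x 0) v) ⟨hx.zero, ?_, ?_⟩) 0)
    · rintro (_ | i)
      · simpa using h2.symm
      · have := h3 i
        rw [Pi.single_eq_of_ne (by omega)] at this
        exact (sub_eq_zero.1 this.symm)
    · rintro (_ | i) hi
      · omega
      · exact h1 i (by omega)
  obtain ⟨G₀, hG₀, hSG₀⟩ := Submodule.exists_le_ker_of_notMem hS
  obtain ⟨G, hG, hSG⟩ : ∃ G : (ℕ → m → ℂ) →ₗ[ℂ] ℂ, G (Pi.single 0 (K.B *ᵥ x 0)) = 1 ∧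
      S ≤ LinearMap.ker G := by
    refine ⟨(G₀ (Pi.single 0 (K.B *ᵥ x 0)))⁻¹ • G₀, ?_, fun u hu => ?_⟩
    · rw [LinearMap.smul_apply, smul_eq_mul, inv_mul_cancel₀ hG₀]
    · have : G₀ u = 0 := hSG₀ hu
      simp [this]
  let g : ℕ → m → ℂ := fun j i => G (Pi.single j (Pi.single i 1))
  have hg (j : ℕ) (w : m → ℂ) : g j ⬝ᵥ w = G (Pi.single j w) := by
    have : (Pi.single j w : ℕ → m → ℂ) = ∑ i, w i • Pi.single j (Pi.single i 1) := by
      ext l i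
      rcases eq_or_ne l j with rfl | h
      · simp [Finset.sum_apply, Pi.single_apply]
      · simp [Finset.sum_apply, h]
    rw [this, map_sum]
    simp [dotProduct, g, mul_comm]
  -- Apply `G` to the element of `S` given by a `v` concentrated in degree `j`, whose only entries
  -- are `A v` and `-B v`.
  have hshift (j : ℕ) (hj : j < e) (v : n → ℂ) : g j ⬝ᵥ K.A *ᵥ v = g (j + 1) ⬝ᵥ K.B *ᵥ v := by
    rw [hg, hg, ← sub_eq_zero, ← map_sub]
    refine hSG ⟨Pi.single j v, fun i hi => Pi.single_eq_of_ne (by omega) _, ?_, fun i => ?_⟩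
    · rcases j with _ | j <;> simp
    · rcases eq_or_ne i j with rfl | h
      · simp
      · rcases eq_or_ne (i + 1) j with rfl | h'
        · simp
        · simp [h, h']
  refine ⟨g, fun j hj => ?_, ?_⟩
  · ext c
    have := hshift j hj (Pi.single c 1)
    rw [dotProduct_mulVec, dotProduct_mulVec] at this
    simpa using this
  -- The pairing is constant along diagonals. Each diagonal then has a known value: beyond the end
  -- of the chain it is 0, at `(0, 0)` it is 1, and at `(d + 1, 0)` it reduces to `A x 0 = 0`.
  have hup (t j i : ℕ) (h : j + t ≤ e) :
      g j ⬝ᵥ K.B *ᵥ x i = g (j + t) ⬝ᵥ K.B *ᵥ x (i + t) := by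
    induction t with
    | zero => rfl
    | succ t ih =>
      rw [ih (by omega), ← hx.succ, hshift _ (by omega)]
      rfl
  intro i j hj
  rcases lt_trichotomy j i with h | rfl | h
  · rw [if_neg h.ne, hup (e - j) j i (by omega), ← hx.succ, hx.eq_zero _ (by omega)]
    simp
  · rw [if_pos rfl]
    have := hup j 0 0 (by omega)
    rw [zero_add] at this
    rw [← this, hg, hG]
  · rw [if_neg h.ne']
    obtain ⟨d, rfl⟩ : ∃ d, j = d + 1 + i := ⟨j - i - 1, by omega⟩
    have := hup i (d + 1) 0 (by omega)
    rw [zero_add] at this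
    rw [← this, ← hshift _ (by omega), hx.zero]
    simp

/-- A null chain of minimal length splits off a Kronecker block. -/
theorem IsNullChain.exists_directSum (hx : K.IsNullChain e x) (h0 : x 0 ≠ 0)
    (hmin : ∀ e' < e, ∀ y, K.IsNullChain e' y → y = 0) :
    ∃ (c d : ℕ) (K' : MatrixPencil (Fin c) (Fin d)), c + e = Fintype.card m ∧
      d + (e + 1) = Fintype.card n ∧
      K.StrictlyEquivalent ((kroneckerBlock e).directSum K') := by
  have hlast : K.B *ᵥ x e = 0 := by rw [← hx.succ, hx.eq_zero _ (by omega), mulVec_zero]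
  suffices h : ∃ (f : Matrix (Fin (e + 1)) n ℂ) (g : Matrix (Fin e) m ℂ),
      (∀ (i : ℕ) (j : Fin (e + 1)), f j ⬝ᵥ x i = if (j : ℕ) = i then 1 else 0) ∧
      (∀ (i : ℕ) (j : Fin e), g j ⬝ᵥ (K.B *ᵥ x i) = if (j : ℕ) = i then 1 else 0) ∧
      (∀ j : Fin e, g j ᵥ* K.A = f j.succ) ∧ ∀ j : Fin e, g j ᵥ* K.B = f j.castSucc by
    obtain ⟨f, g, h1, h2, h3, h4⟩ := h
    have := exists_directSum_of_retraction K (kroneckerBlock e)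
      (Matrix.of fun r (c : Fin (e + 1)) => x c r) f (Matrix.of fun r (c : Fin e) => (K.B *ᵥ x c) r)
      g ?_ ?_ ?_ ?_ ?_ ?_
    · simpa using this
    · ext j c
      rw [Matrix.one_apply]
      refine (h1 c j).trans ?_
      simp [Fin.ext_iff]
    · ext j c
      rw [Matrix.one_apply]
      refine (h2 c j).trans ?_
      simp [Fin.ext_iff]
    · ext r c
      refine Fin.cases ?_ (fun c => ?_) c
      · rw [mul_kroneckerBlock_A_zero]; exact congrFun hx.zero r
      · rw [mul_kroneckerBlock_A_succ]; exact congrFun (hx.succ c) r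
    · ext r c
      refine Fin.lastCases ?_ (fun c => ?_) c
      · rw [mul_kroneckerBlock_B_last]
        exact congrFun hlast r
      · rw [mul_kroneckerBlock_B_castSucc]; rfl
    · ext r c
      rw [kroneckerBlock_A_mul]; exact congrFun (h3 r) c
    · ext r c
      rw [kroneckerBlock_B_mul]; exact congrFun (h4 r) c
  rcases e with _ | e
  -- A block without rows: any functional with value 1 at `x 0` will do.
  · obtain ⟨r, hr⟩ := Function.ne_iff.1 h0
    refine ⟨fun _ => (x 0 r)⁻¹ • Pi.single r 1, fun j => j.elim0, fun i j => ?_,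
      fun _ j => j.elim0, fun j => j.elim0, fun j => j.elim0⟩
    have hj : (j : ℕ) = 0 := by omega
    rcases i with _ | i
    · rw [hj, if_pos rfl]
      simpa using inv_mul_cancel₀ hr
    · rw [hj, if_neg (by omega), hx.eq_zero (i + 1) (by omega)]
      simp
  · obtain ⟨g, hgs, hgx⟩ := hx.exists_functionals h0 (hmin e (by omega))
    -- The shift relations identify `g j A` with the next row `g (j + 1) B`; only the last row `g e
    -- A` has to be added.
    refine ⟨fun j => Fin.lastCases (g e ᵥ* K.A) (fun j => g j ᵥ* K.B) j, fun j => g j,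
      fun i j => ?_, fun i j => hgx i j (by omega), fun j => ?_, fun j => ?_⟩
    · refine Fin.lastCases ?_ (fun j => ?_) j
      · simp only [Fin.lastCases_last, Fin.val_last]
        rw [← dotProduct_mulVec]
        rcases i with _ | i
        · rw [hx.zero, if_neg (by omega), dotProduct_zero]
        · rw [hx.succ, hgx i e le_rfl]
          simp
      · simp only [Fin.lastCases_castSucc, Fin.val_castSucc]
        rw [← dotProduct_mulVec, hgx i j (by omega)]
    · refine Fin.lastCases ?_ (fun j => ?_) j
      · simp
      · simp only [Fin.succ_castSucc, Fin.lastCases_castSucc, Fin.val_castSucc, Fin.val_succ]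
        exact hgs j j.2
    · simp only [Fin.lastCases_castSucc]

end Chain

/-- The coefficients of a polynomial null vector form a null chain. -/
theorem exists_isNullChain_of_polynomial {m n : Type} [Fintype n] {K : MatrixPencil m n}
    (v : n → Polynomial ℂ) (hv : v ≠ 0)
    (h : (K.A.map Polynomial.C - (Polynomial.X : Polynomial ℂ) • K.B.map Polynomial.C) *ᵥ v = 0) :
    ∃ e x, K.IsNullChain e x ∧ x ≠ 0 := by
  have hcoeff (M : Matrix m n ℂ) (i : ℕ) (r : m) :
      ((M.map Polynomial.C *ᵥ v) r).coeff i = (M *ᵥ fun c => (v c).coeff i) r := by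
    simp [mulVec, dotProduct, Polynomial.finsetSum_coeff]
  have h' : K.A.map Polynomial.C *ᵥ v =
      (Polynomial.X : Polynomial ℂ) • (K.B.map Polynomial.C *ᵥ v) := by
    rw [← sub_eq_zero, ← h, sub_mulVec, smul_mulVec]
  refine ⟨Finset.univ.sup fun c => (v c).natDegree, fun i c => (v c).coeff i, ⟨?_, ?_, ?_⟩, ?_⟩
  · ext r
    rw [← hcoeff, h']
    simp
  · intro i
    ext r
    rw [← hcoeff, ← hcoeff, h']
    simp
  · intro i hi
    ext c
    exact Polynomial.coeff_eq_zero_of_natDegree_lt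
      ((Finset.le_sup (f := fun c => (v c).natDegree) (Finset.mem_univ c)).trans_lt hi)
  · intro hx
    refine hv (funext fun c => Polynomial.ext fun i => ?_)
    exact congrFun (congrFun hx i) c

/-! ### Kronecker's theorem -/

/-- The pencil is strictly equivalent to the direct sum of a regular pencil, Kronecker blocks and
transposed Kronecker blocks, indexed by arbitrary finite types. -/
def HasKroneckerForm {m n : Type} [Fintype m] [Fintype n] [DecidableEq m] [DecidableEq n]
    (K : MatrixPencil m n) : Prop :=
  ∃ (r : ℕ) (R : MatrixPencil (Fin r) (Fin r)), R.IsRegular ∧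
    ∃ (ι κ : Type) (_ : Fintype ι) (_ : DecidableEq ι) (_ : Fintype κ) (_ : DecidableEq κ)
      (ε : ι → ℕ) (η : κ → ℕ),
      K.StrictlyEquivalent (R.directSum ((blockDiag fun i => kroneckerBlock (ε i)).directSum
        (blockDiag fun j => (kroneckerBlock (η j)).transpose)))

theorem directSum_transpose {m n a b : Type} (K : MatrixPencil m n) (L : MatrixPencil a b) :
    (K.directSum L).transpose = K.transpose.directSum L.transpose := by
  simp [MatrixPencil.transpose, directSum, fromBlocks_transpose]

section

variable {m n : Type} [Fintype m] [Fintype n] [DecidableEq m] [DecidableEq n]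

theorem IsRegular.transpose {K : MatrixPencil n n} (h : K.IsRegular) : K.transpose.IsRegular := by
  obtain ⟨z, hz⟩ := h
  refine ⟨z, ?_⟩
  rwa [MatrixPencil.transpose, ← transpose_smul, ← transpose_sub, det_transpose]

theorem blockDiag_transpose {ι : Type} [DecidableEq ι] {a b : ι → Type}
    (K : (i : ι) → MatrixPencil (a i) (b i)) :
    (blockDiag K).transpose = blockDiag fun i => (K i).transpose := by
  simp [MatrixPencil.transpose, blockDiag, blockDiagonal'_transpose]

/-- Transposition exchanges the two kinds of blocks, so left null chains need no separate splitting
argument. -/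
theorem HasKroneckerForm.of_transpose {K : MatrixPencil m n} (h : K.transpose.HasKroneckerForm) :
    K.HasKroneckerForm := by
  obtain ⟨r, R, hR, ι, κ, _, _, _, _, ε, η, h⟩ := h
  refine ⟨r, R.transpose, hR.transpose, κ, ι, inferInstance, inferInstance, inferInstance,
    inferInstance, η, ε, h.transpose.trans ?_⟩
  rw [directSum_transpose, directSum_transpose, blockDiag_transpose, blockDiag_transpose]
  refine .directSum (.refl _) ?_
  refine .of_equiv _ _ (Equiv.sumComm _ _) (Equiv.sumComm _ _) ?_ ?_ <;>
  · ext (i | i) (j | j) <;> rfl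

/-- Splitting off the summand of a sigma type over the new element of an `Option` type. -/
def sigmaOptionEquiv {ι : Type} (F : Option ι → Type) :
    (Σ o, F o) ≃ F none ⊕ Σ i, F (some i) where
  toFun := fun | ⟨none, x⟩ => Sum.inl x | ⟨some i, x⟩ => Sum.inr ⟨i, x⟩
  invFun := fun | Sum.inl x => ⟨none, x⟩ | Sum.inr ⟨i, x⟩ => ⟨some i, x⟩
  left_inv := by rintro ⟨_ | i, x⟩ <;> rfl
  right_inv := by rintro (x | ⟨i, x⟩) <;> rfl

theorem directSum_blockDiag_strictlyEquivalent {ι : Type} [Fintype ι] [DecidableEq ι]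
    {a b : Option ι → Type} [∀ i, Fintype (a i)] [∀ i, Fintype (b i)] [∀ i, DecidableEq (a i)]
    [∀ i, DecidableEq (b i)] (K : (i : Option ι) → MatrixPencil (a i) (b i)) :
    ((K none).directSum (blockDiag fun i => K (some i))).StrictlyEquivalent (blockDiag K) := by
  refine .of_equiv _ _ (sigmaOptionEquiv a) (sigmaOptionEquiv b) ?_ ?_ <;>
  · ext ⟨_ | i, x⟩ ⟨_ | j, y⟩
    · simp [directSum, blockDiag, sigmaOptionEquiv, blockDiagonal'_apply_eq]
    · simp [directSum, blockDiag, sigmaOptionEquiv, blockDiagonal'_apply_ne]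
    · simp [directSum, blockDiag, sigmaOptionEquiv, blockDiagonal'_apply_ne]
    · by_cases h : i = j
      · subst h
        simp [directSum, blockDiag, sigmaOptionEquiv, blockDiagonal'_apply_eq]
      · simp [directSum, blockDiag, sigmaOptionEquiv, blockDiagonal'_apply_ne, h]

theorem directSum_left_comm {a b c d : Type} [Fintype a] [DecidableEq a] [Fintype b]
    [DecidableEq b] [Fintype c] [DecidableEq c] [Fintype d] [DecidableEq d]
    (K : MatrixPencil m n) (L : MatrixPencil a b) (M : MatrixPencil c d) {m' n' : Type}
    [Fintype m'] [DecidableEq m'] [Fintype n'] [DecidableEq n'] (N : MatrixPencil m' n') :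
    (K.directSum (L.directSum (M.directSum N))).StrictlyEquivalent
      (L.directSum ((K.directSum M).directSum N)) := by
  let e (a b c d : Type) : a ⊕ ((b ⊕ c) ⊕ d) ≃ b ⊕ (a ⊕ (c ⊕ d)) :=
    { toFun := fun
        | .inl x => .inr (.inl x)
        | .inr (.inl (.inl x)) => .inl x
        | .inr (.inl (.inr x)) => .inr (.inr (.inl x))
        | .inr (.inr x) => .inr (.inr (.inr x))
      invFun := fun
        | .inl x => .inr (.inl (.inl x))
        | .inr (.inl x) => .inl x
        | .inr (.inr (.inl x)) => .inr (.inl (.inr x))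
        | .inr (.inr (.inr x)) => .inr (.inr x)
      left_inv := by rintro (x | (x | x) | x) <;> rfl
      right_inv := by rintro (x | x | x | x) <;> rfl }
  refine .of_equiv _ _ (e _ _ _ _) (e _ _ _ _) ?_ ?_ <;>
  · ext (i | (i | i) | i) (j | (j | j) | j) <;> rfl

theorem HasKroneckerForm.block_directSum {K : MatrixPencil m n} (h : K.HasKroneckerForm) (e : ℕ) :
    ((kroneckerBlock e).directSum K).HasKroneckerForm := by
  obtain ⟨r, R, hR, ι, κ, _, _, _, _, ε, η, h⟩ := h
  refine ⟨r, R, hR, Option ι, κ, inferInstance, inferInstance, inferInstance,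
    inferInstance, fun o => o.elim e ε, η, ?_⟩
  refine ((StrictlyEquivalent.refl _).directSum h).trans ?_
  refine (directSum_left_comm _ _ _ _).trans ?_
  refine .directSum (.refl _) (.directSum ?_ (.refl _))
  exact directSum_blockDiag_strictlyEquivalent fun o : Option ι => kroneckerBlock (o.elim e ε)

theorem HasKroneckerForm.of_strictlyEquivalent {m' n' : Type} [Fintype m'] [Fintype n']
    [DecidableEq m'] [DecidableEq n'] {K : MatrixPencil m n} {L : MatrixPencil m' n'}
    (h : K.StrictlyEquivalent L) (hL : L.HasKroneckerForm) : K.HasKroneckerForm := by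
  obtain ⟨r, R, hR, ι, κ, _, _, _, _, ε, η, hL⟩ := hL
  exact ⟨r, R, hR, ι, κ, inferInstance, inferInstance, inferInstance, inferInstance, ε, η,
    h.trans hL⟩

theorem IsRegular.hasKroneckerForm {r : ℕ} {R : MatrixPencil (Fin r) (Fin r)} (h : R.IsRegular) :
    R.HasKroneckerForm := by
  refine ⟨r, R, h, Empty, Empty, inferInstance, inferInstance, inferInstance, inferInstance,
    Empty.elim, Empty.elim, ?_⟩
  refine .of_equiv _ _ (Equiv.sumEmpty _ _) (Equiv.sumEmpty _ _) ?_ ?_ <;>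
  · ext (i | ⟨⟨i, _⟩ | ⟨i, _⟩⟩) (j | ⟨⟨j, _⟩ | ⟨j, _⟩⟩)
    · rfl
    all_goals first | exact i.elim | exact j.elim

/-- A nonzero null chain yields a splitting. -/
theorem exists_kroneckerBlock_directSum {K : MatrixPencil m n}
    (h : ∃ e x, K.IsNullChain e x ∧ x ≠ 0) :
    ∃ (e c d : ℕ) (K' : MatrixPencil (Fin c) (Fin d)), c + e = Fintype.card m ∧
      d + (e + 1) = Fintype.card n ∧
      K.StrictlyEquivalent ((kroneckerBlock e).directSum K') := by
  classical
  obtain ⟨x, hx, hx0⟩ := Nat.find_spec h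
  have hmin : ∀ e' < Nat.find h, ∀ y, K.IsNullChain e' y → y = 0 := fun e' he' y hy =>
    by_contra fun hy0 => Nat.find_min h he' ⟨y, hy, hy0⟩
  refine ⟨Nat.find h, hx.exists_directSum (fun h0 => hx0 ?_) hmin⟩
  -- If `x 0 = 0`, dividing the null vector by `λ` gives a chain of smaller degree, which vanishes
  -- by minimality.
  have hshift : ∀ i, x (i + 1) = 0 := by
    rcases he : Nat.find h with _ | e
    · exact fun i => hx.eq_zero (i + 1) (by omega)
    · have := hmin e (by omega) (fun i => x (i + 1))
        ⟨by rw [hx.succ, h0, mulVec_zero], fun i => hx.succ (i + 1),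
          fun i hi => hx.eq_zero (i + 1) (by omega)⟩
      exact fun i => congrFun this i
  funext i
  rcases i with _ | i
  exacts [h0, hshift i]

/-- Kronecker's theorem, with blocks indexed by arbitrary finite types. -/
theorem hasKroneckerForm {m n : ℕ} (K : MatrixPencil (Fin m) (Fin n)) : K.HasKroneckerForm := by
  induction hN : m + n using Nat.strong_induction_on generalizing m n with
  | _ N ih =>
  by_cases h : ∃ e x, K.IsNullChain e x ∧ x ≠ 0
  · obtain ⟨e, c, d, K', hc, hd, hK⟩ := exists_kroneckerBlock_directSum h
    rw [Fintype.card_fin] at hc hd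
    exact .of_strictlyEquivalent hK ((ih _ (by omega) K' rfl).block_directSum e)
  by_cases h' : ∃ e x, K.transpose.IsNullChain e x ∧ x ≠ 0
  · obtain ⟨e, c, d, K', hc, hd, hK⟩ := exists_kroneckerBlock_directSum h'
    rw [Fintype.card_fin] at hc hd
    exact .of_transpose (.of_strictlyEquivalent hK ((ih _ (by omega) K' rfl).block_directSum e))
  -- Without null chains the pencil is injective over `ℂ[λ]`, hence has at most as many columns as
  -- rows. The same holds for the transpose, so the pencil is square.
  have hinj {c d : ℕ} (L : MatrixPencil (Fin c) (Fin d)) (hL : ¬ ∃ e x, L.IsNullChain e x ∧ x ≠ 0)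
      (v : Fin d → Polynomial ℂ) (hv : (L.A.map Polynomial.C -
        (Polynomial.X : Polynomial ℂ) • L.B.map Polynomial.C) *ᵥ v = 0) : v = 0 :=
    by_contra fun hv0 => hL (exists_isNullChain_of_polynomial v hv0 hv)
  have hle {c d : ℕ} (L : MatrixPencil (Fin c) (Fin d))
      (hL : ¬ ∃ e x, L.IsNullChain e x ∧ x ≠ 0) : d ≤ c :=
    le_of_fin_injective (R := Polynomial ℂ) (mulVecLin _)
      (LinearMap.ker_eq_bot.1 (LinearMap.ker_eq_bot'.2 (hinj L hL)))
  obtain rfl : m = n := le_antisymm (hle _ h') (hle _ h)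
  refine IsRegular.hasKroneckerForm ?_
  have hdet :
      (K.A.map Polynomial.C - (Polynomial.X : Polynomial ℂ) • K.B.map Polynomial.C).det ≠ 0 :=
    fun hdet => by
      obtain ⟨v, hv0, hv⟩ := exists_mulVec_eq_zero_iff.2 hdet
      exact hv0 (hinj K h v hv)
  by_contra hreg
  refine hdet (Polynomial.funext fun z => ?_)
  rw [Polynomial.eval_zero, ← Polynomial.coe_evalRingHom, RingHom.map_det]
  refine Eq.trans (congrArg det ?_) (not_not.1 (not_exists.1 hreg z))
  ext i j
  simp [mul_comm (K.B i j)]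

theorem blockDiag_comp_strictlyEquivalent {ι κ : Type} [Fintype ι] [DecidableEq ι] [Fintype κ]
    [DecidableEq κ] {a b : ι → Type} [∀ i, Fintype (a i)] [∀ i, Fintype (b i)]
    [∀ i, DecidableEq (a i)] [∀ i, DecidableEq (b i)] (K : (i : ι) → MatrixPencil (a i) (b i))
    (σ : κ ≃ ι) : (blockDiag K).StrictlyEquivalent (blockDiag fun i => K (σ i)) := by
  have key (M : (i : ι) → Matrix (a i) (b i) ℂ) : (blockDiagonal' M).submatrix
      (Equiv.sigmaCongrLeft σ) (Equiv.sigmaCongrLeft σ) = blockDiagonal' fun i => M (σ i) := by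
    ext ⟨i, x⟩ ⟨j, y⟩
    by_cases h : i = j
    · subst h
      exact (blockDiagonal'_apply_eq M (σ i) x y).trans
        (blockDiagonal'_apply_eq (fun i => M (σ i)) i x y).symm
    · exact (blockDiagonal'_apply_ne M x y (σ.injective.ne h)).trans
        (blockDiagonal'_apply_ne (fun i => M (σ i)) x y h).symm
  exact .of_equiv _ _ (Equiv.sigmaCongrLeft σ) (Equiv.sigmaCongrLeft σ)
    (key fun i => (K i).A) (key fun i => (K i).B)

/-- Kronecker's theorem. -/
theorem exists_isRegularPart {m n : ℕ} (K : MatrixPencil (Fin m) (Fin n)) :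
    ∃ (r : ℕ) (R : MatrixPencil (Fin r) (Fin r)), K.IsRegularPart R := by
  obtain ⟨r, R, hR, ι, κ, _, _, _, _, ε, η, h⟩ := K.hasKroneckerForm
  refine ⟨r, R, hR, Fintype.card ι, Fintype.card κ, ε ∘ (Fintype.equivFin ι).symm,
    η ∘ (Fintype.equivFin κ).symm, h.trans (.directSum (.refl _) (.directSum ?_ ?_))⟩
  · exact blockDiag_comp_strictlyEquivalent _ (Fintype.equivFin ι).symm
  · exact blockDiag_comp_strictlyEquivalent (fun j => (kroneckerBlock (η j)).transpose)
      (Fintype.equivFin κ).symm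

end

/-! ### Homogeneous values -/

/-- The value of a pencil at a point of the projective line with coordinates `(a, b)`. -/
def homValue {m n : Type} (K : MatrixPencil m n) (a b : ℂ) : Matrix m n ℂ := b • K.A - a • K.B

theorem valueAt_coe {m n : Type} (K : MatrixPencil m n) (z : ℂ) :
    K.valueAt (z : OnePoint ℂ) = K.homValue z 1 := by
  simp [valueAt, homValue]

theorem valueAt_infty {m n : Type} (K : MatrixPencil m n) :
    K.valueAt OnePoint.infty = (-1 : ℂ) • K.homValue 1 0 := by
  simp [valueAt, homValue]

theorem homValue_transpose {m n : Type} (K : MatrixPencil m n) (a b : ℂ) :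
    K.transpose.homValue a b = (K.homValue a b)ᵀ := by
  simp [homValue, transpose]

theorem homValue_directSum {m n c d : Type} (K : MatrixPencil m n) (L : MatrixPencil c d)
    (a b : ℂ) :
    (K.directSum L).homValue a b = fromBlocks (K.homValue a b) 0 0 (L.homValue a b) := by
  ext (i | i) (j | j) <;> simp [homValue, directSum]

theorem homValue_conj {m n m' n' : Type} [Fintype m] [Fintype n] {K : MatrixPencil m n}
    {L : MatrixPencil m' n'} {P : Matrix m' m ℂ} {Q : Matrix n n' ℂ} (hA : P * K.A * Q = L.A)
    (hB : P * K.B * Q = L.B) (a b : ℂ) : P * K.homValue a b * Q = L.homValue a b := by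
  simp [homValue, ← hA, ← hB, Matrix.mul_sub, Matrix.sub_mul]

theorem homValue_perturb {m n k : Type} [Fintype k] (K : MatrixPencil m n) (U : Matrix m k ℂ)
    (V : Matrix n k ℂ) (D : MatrixPencil k k) (τ a b : ℂ) :
    (K.perturb U V D τ).homValue a b = K.homValue a b + τ • (U * D.homValue a b * Vᴴ) := by
  simp only [homValue, perturb, Matrix.mul_sub, Matrix.sub_mul, smul_add, smul_sub, Matrix.mul_smul,
    Matrix.smul_mul, smul_comm τ]
  abel

/-! ### Direct sums of Kronecker blocks -/

section Blocks

variable {ι : Type} [Fintype ι] [DecidableEq ι] (ε : ι → ℕ)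

theorem blockDiag_kroneckerBlock_A_mul {n : Type} (M : Matrix (Σ i, Fin (ε i + 1)) n ℂ) (i : ι)
    (r : Fin (ε i)) (c : n) :
    ((blockDiag fun i => kroneckerBlock (ε i)).A * M) ⟨i, r⟩ c = M ⟨i, r.succ⟩ c := by
  rw [Matrix.mul_apply, Finset.sum_eq_single ⟨i, r.succ⟩]
  · simp [blockDiag, blockDiagonal'_apply_eq, kroneckerBlock]
  · rintro ⟨j, s⟩ - h
    rcases eq_or_ne i j with rfl | hij
    · have : s ≠ r.succ := fun h' => h (by rw [h'])
      simp [blockDiag, blockDiagonal'_apply_eq, kroneckerBlock, this]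
    · simp [blockDiag, blockDiagonal'_apply_ne, hij]
  · simp

theorem blockDiag_kroneckerBlock_B_mul {n : Type} (M : Matrix (Σ i, Fin (ε i + 1)) n ℂ) (i : ι)
    (r : Fin (ε i)) (c : n) :
    ((blockDiag fun i => kroneckerBlock (ε i)).B * M) ⟨i, r⟩ c = M ⟨i, r.castSucc⟩ c := by
  rw [Matrix.mul_apply, Finset.sum_eq_single ⟨i, r.castSucc⟩]
  · simp [blockDiag, blockDiagonal'_apply_eq, kroneckerBlock]
  · rintro ⟨j, s⟩ - h
    rcases eq_or_ne i j with rfl | hij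
    · have : s ≠ r.castSucc := fun h' => h (by rw [h'])
      simp [blockDiag, blockDiagonal'_apply_eq, kroneckerBlock, this]
    · simp [blockDiag, blockDiagonal'_apply_ne, hij]
  · simp

theorem blockDiag_kroneckerBlock_homValue_mulVec (a b : ℂ) (x : (Σ i, Fin (ε i + 1)) → ℂ) (i : ι)
    (r : Fin (ε i)) : ((blockDiag fun i => kroneckerBlock (ε i)).homValue a b *ᵥ x) ⟨i, r⟩ =
      b * x ⟨i, r.succ⟩ - a * x ⟨i, r.castSucc⟩ := by
  have hA := blockDiag_kroneckerBlock_A_mul ε (replicateCol Unit x) i r ()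
  have hB := blockDiag_kroneckerBlock_B_mul ε (replicateCol Unit x) i r ()
  rw [homValue, sub_mulVec, smul_mulVec, smul_mulVec, Pi.sub_apply, Pi.smul_apply, Pi.smul_apply]
  exact congrArg₂ (fun s t => b * s - a * t) hA hB

/-- A basis of the null space of the direct sum of Kronecker blocks at `(a, b)`. -/
def kroneckerNull (a b : ℂ) : Matrix (Σ i, Fin (ε i + 1)) ι ℂ :=
  Matrix.of fun p j => if p.1 = j then b ^ (ε p.1 - p.2) * a ^ (p.2 : ℕ) else 0

theorem kroneckerNull_mulVec (a b : ℂ) (c : ι → ℂ) (i : ι) (r : Fin (ε i + 1)) :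
    (kroneckerNull ε a b *ᵥ c) ⟨i, r⟩ = b ^ (ε i - r) * a ^ (r : ℕ) * c i := by
  simp [kroneckerNull, mulVec, dotProduct]

theorem blockDiag_kroneckerBlock_mul_kroneckerNull (a b : ℂ) :
    (blockDiag fun i => kroneckerBlock (ε i)).homValue a b * kroneckerNull ε a b = 0 := by
  refine Matrix.ext_of_mulVec_single fun j => ?_
  ext ⟨i, r⟩
  rw [← mulVec_mulVec, blockDiag_kroneckerBlock_homValue_mulVec, kroneckerNull_mulVec,
    kroneckerNull_mulVec, zero_mulVec, Pi.zero_apply, Fin.val_succ, Fin.val_castSucc,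
    show ε i - r = ε i - (r + 1) + 1 by omega]
  ring

theorem exists_mul_kroneckerNull_eq_one {a b : ℂ} (h : a ≠ 0 ∨ b ≠ 0) :
    ∃ M : Matrix ι (Σ i, Fin (ε i + 1)) ℂ, M * kroneckerNull ε a b = 1 := by
  suffices h : ∃ (f : (i : ι) → Fin (ε i + 1)) (d : ι → ℂ),
      ∀ i, d i * (b ^ (ε i - f i) * a ^ (f i : ℕ)) = 1 by
    obtain ⟨f, d, h⟩ := h
    refine ⟨Matrix.of fun i p => if p = ⟨i, f i⟩ then d i else 0, ?_⟩
    ext i j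
    rw [Matrix.mul_apply, Finset.sum_eq_single ⟨i, f i⟩]
    · simp [kroneckerNull, Matrix.one_apply, h]
    · rintro p - hp
      simp [hp]
    · simp
  -- Each column contains `a ^ ε i` in its last entry and `b ^ ε i` in its first, and one of these
  -- is nonzero.
  rcases eq_or_ne b 0 with rfl | hb
  · have ha : a ≠ 0 := by simpa using h
    exact ⟨fun i => Fin.last _, fun i => (a ^ ε i)⁻¹, fun i => by simp [ha]⟩
  · exact ⟨fun i => 0, fun i => (b ^ ε i)⁻¹, fun i => by simp [hb]⟩

/-- The equations are the recurrences `b x_{r+1} - a x_r = y_r`. They are solved forward from `x_0 =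
0` if `b ≠ 0`, and decouple if `b = 0`. -/
theorem exists_blockDiag_kroneckerBlock_mulVec {a b : ℂ} (h : a ≠ 0 ∨ b ≠ 0)
    (y : (Σ i, Fin (ε i)) → ℂ) :
    ∃ x, (blockDiag fun i => kroneckerBlock (ε i)).homValue a b *ᵥ x = y := by
  rcases eq_or_ne b 0 with rfl | hb
  · have ha : a ≠ 0 := by simpa using h
    refine ⟨fun p => Fin.lastCases (motive := fun _ => ℂ) 0 (fun r => -y ⟨p.1, r⟩ / a) p.2, ?_⟩
    ext ⟨i, r⟩
    rw [blockDiag_kroneckerBlock_homValue_mulVec]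
    simp only [Fin.lastCases_castSucc]
    field_simp
    simp
  · refine ⟨fun p => Fin.induction (motive := fun _ => ℂ) 0
      (fun r t => (y ⟨p.1, r⟩ + a * t) / b) p.2, ?_⟩
    ext ⟨i, r⟩
    rw [blockDiag_kroneckerBlock_homValue_mulVec]
    simp only [Fin.induction_succ]
    field_simp
    ring

theorem rank_blockDiag_kroneckerBlock {a b : ℂ} (h : a ≠ 0 ∨ b ≠ 0) :
    ((blockDiag fun i => kroneckerBlock (ε i)).homValue a b).rank = ∑ i, ε i := by
  rw [Matrix.rank, LinearMap.range_eq_top.2 fun y => exists_blockDiag_kroneckerBlock_mulVec ε h y,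
    finrank_top, Module.finrank_fintype_fun_eq_card, Fintype.card_sigma]
  simp

end Blocks

theorem rank_fromBlocks_diagonal {a b c d : Type} [Fintype b] [Fintype d]
    (A : Matrix a b ℂ) (D : Matrix c d ℂ) : (fromBlocks A 0 0 D).rank = A.rank + D.rank := by
  have e : LinearMap.ker (fromBlocks A 0 0 D).mulVecLin ≃ₗ[ℂ]
      LinearMap.ker A.mulVecLin × LinearMap.ker D.mulVecLin :=
    { toFun := fun x => (⟨x.1 ∘ Sum.inl, by
          have := x.2
          rw [LinearMap.mem_ker, mulVecLin_apply, fromBlocks_mulVec] at this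
          ext i
          simpa using congrFun this (Sum.inl i)⟩, ⟨x.1 ∘ Sum.inr, by
          have := x.2
          rw [LinearMap.mem_ker, mulVecLin_apply, fromBlocks_mulVec] at this
          ext i
          simpa using congrFun this (Sum.inr i)⟩)
      invFun := fun x => ⟨Sum.elim x.1.1 x.2.1, by
          have h1 : A *ᵥ x.1.1 = 0 := x.1.2
          have h2 : D *ᵥ x.2.1 = 0 := x.2.2
          rw [LinearMap.mem_ker, mulVecLin_apply, fromBlocks_mulVec]
          ext (i | i) <;> simp [h1, h2]⟩
      map_add' := fun x y => rfl
      map_smul' := fun x y => rfl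
      left_inv := fun x => by ext (i | i) <;> rfl
      right_inv := fun x => rfl }
  have h := e.finrank_eq
  rw [Module.finrank_prod] at h
  have h1 := A.mulVecLin.finrank_range_add_finrank_ker
  have h2 := D.mulVecLin.finrank_range_add_finrank_ker
  have h3 := (fromBlocks A 0 0 D).mulVecLin.finrank_range_add_finrank_ker
  simp only [Module.finrank_fintype_fun_eq_card, Fintype.card_sum] at h1 h2 h3
  simp only [Matrix.rank]
  omega

/-! ### Deflating subspaces -/

/-- Spectral mapping. Size 0 is separate because the spectrum is empty there. -/
theorem isUnit_aeval_matrix {r : Type} [Fintype r] [DecidableEq r] (G : Matrix r r ℂ)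
    (p : Polynomial ℂ) (h : ∀ g ∈ spectrum ℂ G, p.eval g ≠ 0) :
    IsUnit (Polynomial.aeval G p) := by
  rcases isEmpty_or_nonempty r with hr | hr
  · exact isUnit_of_subsingleton _
  · by_contra hu
    have h0 := (spectrum.zero_mem_iff ℂ).2 hu
    rw [spectrum.map_polynomial_aeval_of_nonempty _ _
      (spectrum.nonempty_of_isAlgClosed_of_finiteDimensional ℂ G)] at h0
    obtain ⟨g, hg, hg0⟩ := h0
    exact h g hg hg0

/-- The coordinate `g = 1 / (z - μ)` covers the projective line except `μ`, with `∞` at `g = 0`. It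
turns the eigenvalues of `R`, infinite ones included, into those of a single matrix. -/
theorem homValue_eq_mul {r : Type} [Fintype r] [DecidableEq r] {R : MatrixPencil r r} {μ : ℂ}
    (hμ : (R.homValue μ 1).det ≠ 0) (g : ℂ) : R.homValue (1 + μ * g) g =
      R.homValue μ 1 * (algebraMap ℂ _ g - (R.homValue μ 1)⁻¹ * R.B) := by
  rw [Matrix.mul_sub, ← Matrix.mul_assoc, mul_nonsing_inv _ (isUnit_iff_ne_zero.2 hμ),
    Matrix.one_mul, Algebra.algebraMap_eq_smul_one, Matrix.mul_smul, Matrix.mul_one]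
  simp only [homValue, add_smul, mul_smul, one_smul, smul_sub, smul_comm g μ]
  abel

theorem det_homValue_eq_zero_iff {r : Type} [Fintype r] [DecidableEq r] {R : MatrixPencil r r}
    {μ : ℂ} (hμ : (R.homValue μ 1).det ≠ 0) (g : ℂ) :
    (R.homValue (1 + μ * g) g).det = 0 ↔ g ∈ spectrum ℂ ((R.homValue μ 1)⁻¹ * R.B) := by
  rw [homValue_eq_mul hμ, det_mul, mul_eq_zero, or_iff_right hμ, spectrum.mem_iff,
    isUnit_iff_isUnit_det, isUnit_iff_ne_zero, not_not]

section Deflation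

variable {ι : Type} [Fintype ι] [DecidableEq ι] (ε : ι → ℕ) {r : Type} [Fintype r] [DecidableEq r]
  {R : MatrixPencil r r} {μ : ℂ}

/-- If the perturbation does not annihilate null vectors of the Kronecker blocks at the eigenvalues
of the regular pencil, then the regular pencil embeds into the direct sum inside the kernel of the
perturbation. -/
theorem exists_deflation (hμ : (R.homValue μ 1).det ≠ 0) (W₁ : Matrix ι r ℂ)
    (W₂ : Matrix ι (Σ i, Fin (ε i + 1)) ℂ)
    (h : ∀ g, (R.homValue (1 + μ * g) g).det = 0 →
      (W₂ * kroneckerNull ε (1 + μ * g) g).det ≠ 0) :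
    ∃ (X : Matrix (Σ i, Fin (ε i + 1)) r ℂ) (Y : Matrix (Σ i, Fin (ε i)) r ℂ),
      (blockDiag fun i => kroneckerBlock (ε i)).A * X = Y * R.A ∧
      (blockDiag fun i => kroneckerBlock (ε i)).B * X = Y * R.B ∧ W₁ + W₂ * X = 0 := by
  set S := (R.homValue μ 1)⁻¹ with hS
  set G := S * R.B with hG
  set H : Matrix r r ℂ := 1 + μ • G with hH
  have hSA : S * R.A = H := by
    have : S * R.homValue μ 1 = 1 := nonsing_inv_mul _ (isUnit_iff_ne_zero.2 hμ)
    rw [homValue, one_smul, Matrix.mul_sub, Matrix.mul_smul] at this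
    rw [hH, ← this, hG, sub_add_cancel]
  have hGH : Commute G H := (Commute.one_right G).add_right ((Commute.refl G).smul_right μ)
  -- `F` is `W₂` times the null vectors of the blocks, as polynomials in `g`. With `G` and `H` in
  -- place of `g` and `1 + μ * g`, it becomes the coefficient matrix of the equation for `X`.
  let F : Matrix ι ι (Polynomial ℂ) := Matrix.of fun j i => ∑ c : Fin (ε i + 1),
    Polynomial.C (W₂ j ⟨i, c⟩) *
      (Polynomial.X ^ (ε i - c) * (1 + Polynomial.C μ * Polynomial.X) ^ (c : ℕ))
  have hF (g : ℂ) : F.map (Polynomial.eval g) = W₂ * kroneckerNull ε (1 + μ * g) g := by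
    ext j i
    simp only [F, Matrix.map_apply, Matrix.of_apply, Polynomial.eval_finsetSum, Matrix.mul_apply,
      Fintype.sum_sigma]
    rw [Finset.sum_eq_single i]
    · simp [kroneckerNull]
    · rintro i' - hi'
      simp [kroneckerNull, hi']
    · simp
  have hFG (j i : ι) : Polynomial.aeval G (F j i) =
      ∑ c : Fin (ε i + 1), W₂ j ⟨i, c⟩ • (G ^ (ε i - c) * H ^ (c : ℕ)) := by
    simp [F, hH, Algebra.algebraMap_eq_smul_one]
  have hu : IsUnit (Polynomial.aeval G F.det) := by
    refine isUnit_aeval_matrix G _ fun g hg => ?_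
    rw [← Polynomial.coe_evalRingHom, RingHom.map_det]
    have := h g ((det_homValue_eq_zero_iff hμ g).2 hg)
    rwa [← hF] at this
  obtain ⟨u, hu⟩ := hu.exists_left_inv
  -- Cramer's rule over the commutative algebra `ℂ[G]`, with `u` the inverse of the determinant.
  let t (i : ι) : r → ℂ := ∑ l, -(W₁ l) ᵥ* (u * Polynomial.aeval G (F.adjugate i l))
  have ht (j : ι) : ∑ i, t i ᵥ* Polynomial.aeval G (F j i) = -W₁ j := by
    have h1 (l : ι) : ∑ i, u * Polynomial.aeval G (F.adjugate i l) * Polynomial.aeval G (F j i) =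
        (1 : Matrix ι ι ℂ) j l • 1 := by
      have := congrFun (congrFun (mul_adjugate F) j) l
      rw [Matrix.mul_apply, Matrix.smul_apply, smul_eq_mul] at this
      simp only [Matrix.mul_assoc, ← Finset.mul_sum, ← map_mul, ← map_sum, mul_comm _ (F j _)]
      rw [this, map_mul, ← Matrix.mul_assoc, hu, Matrix.one_mul, Matrix.one_apply,
        Matrix.one_apply]
      split_ifs <;> simp
    simp only [t, sum_vecMul]
    rw [Finset.sum_comm]
    simp only [vecMul_vecMul, ← vecMul_sum, h1]
    simp only [vecMul_smul, vecMul_one]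
    rw [Finset.sum_eq_single j]
    · simp
    · rintro l - hl
      simp [hl.symm]
    · simp
  -- Since `S * R.A = H` and `S * R.B = G` commute, these null vectors at `(H, G)` satisfy the
  -- intertwining relations for arbitrary rows `t i`.
  let X : Matrix (Σ i, Fin (ε i + 1)) r ℂ := Matrix.of fun p =>
    t p.1 ᵥ* (G ^ (ε p.1 - p.2) * H ^ (p.2 : ℕ))
  let Y : Matrix (Σ i, Fin (ε i)) r ℂ := Matrix.of fun p =>
    t p.1 ᵥ* (G ^ (ε p.1 - (p.2 + 1)) * H ^ (p.2 : ℕ) * S)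
  refine ⟨X, Y, ?_, ?_, ?_⟩
  · ext ⟨i, c⟩ l
    rw [blockDiag_kroneckerBlock_A_mul, mul_apply_eq_vecMul]
    refine congrFun (?_ : t i ᵥ* _ = t i ᵥ* _ ᵥ* _) l
    rw [vecMul_vecMul, Matrix.mul_assoc _ S, hSA, Matrix.mul_assoc (G ^ _), ← pow_succ]
    rfl
  · ext ⟨i, c⟩ l
    rw [blockDiag_kroneckerBlock_B_mul, mul_apply_eq_vecMul]
    refine congrFun (?_ : t i ᵥ* _ = t i ᵥ* _ ᵥ* _) l
    rw [vecMul_vecMul, Matrix.mul_assoc _ S, ← hG, Matrix.mul_assoc (G ^ _),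
      ← (hGH.pow_right _).eq, ← Matrix.mul_assoc, ← pow_succ]
    have : ε i - (c + 1) + 1 = ε i - c := by omega
    simp only [Fin.val_castSucc, this]
  · rw [add_eq_zero_iff_eq_neg']
    funext j
    change _ = -(W₁ j)
    rw [mul_apply_eq_vecMul, vecMul_eq_sum, ← ht, Fintype.sum_sigma]
    refine Finset.sum_congr rfl fun i _ => ?_
    rw [hFG, vecMul_sum]
    refine Finset.sum_congr rfl fun c _ => ?_
    rw [vecMul_smul]
    rfl

end Deflation

/-! ### Null spaces of perturbations and block diagonalisation -/

/-- Multiplication by `N` removes `K` and leaves `τ (N U) D (W x) = 0`, where `N U` and `D` are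
invertible. -/
theorem add_smul_mulVec_eq_zero_iff {m n k : Type} [Fintype m] [Fintype n] [Fintype k]
    [DecidableEq k] {K : Matrix m n ℂ} {N : Matrix k m ℂ} (hN : N * K = 0) {U : Matrix m k ℂ}
    {D : Matrix k k ℂ} {W : Matrix k n ℂ} {τ : ℂ} (hτ : τ ≠ 0) (hD : D.det ≠ 0)
    (hU : (N * U).det ≠ 0) (x : n → ℂ) :
    (K + τ • (U * D * W)) *ᵥ x = 0 ↔ K *ᵥ x = 0 ∧ W *ᵥ x = 0 := by
  constructor
  · intro h
    have hW : W *ᵥ x = 0 := by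
      have h' := congrArg (fun y => N *ᵥ y) h
      simp only [mulVec_mulVec, Matrix.mul_add, hN, zero_add, mulVec_zero, Matrix.mul_smul,
        smul_mulVec, ← Matrix.mul_assoc] at h'
      rw [smul_eq_zero, or_iff_right hτ, ← mulVec_mulVec] at h'
      exact eq_zero_of_mulVec_eq_zero (by rw [det_mul]; exact mul_ne_zero hU hD) h'
    rw [add_mulVec, smul_mulVec, ← mulVec_mulVec, hW, mulVec_zero, smul_zero, add_zero] at h
    exact ⟨h, hW⟩
  · rintro ⟨h, hW⟩
    rw [add_mulVec, smul_mulVec, ← mulVec_mulVec, hW, mulVec_zero, smul_zero, add_zero, h]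

theorem vecMul_add_smul_eq_zero_iff {m n k : Type} [Fintype m] [Fintype n] [Fintype k]
    [DecidableEq k] {K : Matrix m n ℂ} {T : Matrix n k ℂ} (hT : K * T = 0) {U : Matrix m k ℂ}
    {D : Matrix k k ℂ} {W : Matrix k n ℂ} {τ : ℂ} (hτ : τ ≠ 0) (hD : D.det ≠ 0)
    (hW : (W * T).det ≠ 0) (y : m → ℂ) :
    y ᵥ* (K + τ • (U * D * W)) = 0 ↔ y ᵥ* K = 0 ∧ y ᵥ* U = 0 := by
  have := add_smul_mulVec_eq_zero_iff (K := Kᵀ) (N := Tᵀ) (U := Wᵀ) (D := Dᵀ) (W := Uᵀ)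
    (by rw [← transpose_mul, hT, transpose_zero]) hτ (by rwa [det_transpose])
    (by rwa [← transpose_mul, det_transpose]) y
  rwa [mulVec_transpose, mulVec_transpose, ← transpose_mul, ← transpose_mul, ← Matrix.mul_assoc,
    ← transpose_smul, ← transpose_add, mulVec_transpose] at this

/-- Block diagonalisation by a pair of right and a pair of left deflating subspaces. -/
theorem mul_mul_eq_fromBlocks_diagonal {r m n : Type} [Fintype r] [Fintype m] [Fintype n]
    [DecidableEq r] [DecidableEq m] [DecidableEq n] {M : Matrix (r ⊕ m) (r ⊕ n) ℂ}
    {R : Matrix r r ℂ} {X : Matrix n r ℂ} {Y : Matrix m r ℂ} {Z : Matrix r m ℂ} {W : Matrix r n ℂ}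
    (hX : M * fromRows (1 : Matrix r r ℂ) X = fromRows (1 : Matrix r r ℂ) Y * R)
    (hZ : fromCols (1 : Matrix r r ℂ) Z * M = R * fromCols (1 : Matrix r r ℂ) W)
    (hZY : Z * Y = 0) (hWX : W * X = 0) :
    fromBlocks 1 Z (-Y) (1 - Y * Z) * M * fromBlocks 1 (-W) X 1 =
      fromBlocks R 0 0
        (fromCols (-Y) (1 - Y * Z : Matrix m m ℂ) * M * fromRows (-W) (1 : Matrix n n ℂ)) := by
  rw [← fromRows_fromCols_eq_fromBlocks, ← fromCols_fromRows_eq_fromBlocks 1,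
    fromRows_mul, fromRows_mul_fromCols, hZ, Matrix.mul_assoc R, fromCols_mul_fromRows,
    Matrix.mul_assoc R, fromCols_mul_fromRows, Matrix.mul_assoc _ M, hX, ← Matrix.mul_assoc _ _ R,
    fromCols_mul_fromRows]
  simp [hWX, Matrix.sub_mul, Matrix.mul_assoc, hZY]

/-- The first matrix is a product of a lower and an upper unitriangular factor; `Z * Y = 0`
simplifies the product of their inverses. -/
theorem fromBlocks_deflation_inverse {r m : Type} [Fintype r] [Fintype m]
    [DecidableEq r] [DecidableEq m] {Y : Matrix m r ℂ} {Z : Matrix r m ℂ}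
    (h : Z * Y = 0) :
    fromBlocks 1 Z (-Y) (1 - Y * Z) * fromBlocks 1 (-Z) Y 1 = 1 ∧
      fromBlocks 1 (-Z) Y 1 * fromBlocks 1 Z (-Y) (1 - Y * Z) = 1 := by
  have h' : Z * (Y * Z) = 0 := by rw [← Matrix.mul_assoc, h, Matrix.zero_mul]
  constructor <;>
  simp [fromBlocks_multiply, Matrix.sub_mul, Matrix.mul_sub, Matrix.mul_assoc, h, h']

/-! ### Ranks of the values of a pencil -/

theorem rank_smul_of_ne_zero {m n : Type} [Fintype n] {c : ℂ} (hc : c ≠ 0) (M : Matrix m n ℂ) :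
    (c • M).rank = M.rank := by
  rw [Matrix.rank, Matrix.rank, show (c • M).mulVecLin = c • M.mulVecLin from
    LinearMap.ext fun x => smul_mulVec c M x, LinearMap.range_smul _ _ hc]

theorem rank_lt_card_iff {n : Type} [Fintype n] [DecidableEq n] (M : Matrix n n ℂ) :
    M.rank < Fintype.card n ↔ M.det = 0 := by
  refine ⟨fun h => by_contra fun hM => h.ne (rank_of_det_ne_zero hM), fun h => ?_⟩
  refine (rank_le_card_width M).lt_of_ne fun hr => ?_
  obtain ⟨v, hv, hMv⟩ := exists_mulVec_eq_zero_iff.2 h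
  have h1 := M.mulVecLin.finrank_range_add_finrank_ker
  rw [Module.finrank_fintype_fun_eq_card] at h1
  have h2 : Module.finrank ℂ (LinearMap.ker M.mulVecLin) = 0 := by
    rw [Matrix.rank] at hr; omega
  have h3 : v ∈ LinearMap.ker M.mulVecLin := hMv
  rw [Submodule.finrank_eq_zero.1 h2] at h3
  exact hv h3

/-- Adding a term that is injective on a complement of the common null space raises the rank by
the number of columns. -/
theorem rank_add_smul {m n k : Type} [Fintype m] [Fintype n] [Fintype k]
    [DecidableEq k] {K : Matrix m n ℂ} {N : Matrix k m ℂ} (hN : N * K = 0) {T : Matrix n k ℂ}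
    (hT : K * T = 0) {U : Matrix m k ℂ} {D : Matrix k k ℂ} {W : Matrix k n ℂ} {τ : ℂ}
    (hτ : τ ≠ 0) (hD : D.det ≠ 0) (hU : (N * U).det ≠ 0) (hW : (W * T).det ≠ 0) :
    (K + τ • (U * D * W)).rank = K.rank + Fintype.card k := by
  set M := K + τ • (U * D * W)
  let f := W.mulVecLin.domRestrict (LinearMap.ker K.mulVecLin)
  -- `T (W T)⁻¹` is a right inverse with values in `ker K`, so imposing `W x = 0` on `ker K` costs
  -- exactly `k` dimensions.
  have hf : Function.Surjective f := fun c => by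
    refine ⟨⟨T *ᵥ ((W * T)⁻¹ *ᵥ c), ?_⟩, ?_⟩
    · rw [LinearMap.mem_ker, mulVecLin_apply, mulVec_mulVec, hT, zero_mulVec]
    · change W *ᵥ (T *ᵥ ((W * T)⁻¹ *ᵥ c)) = c
      rw [mulVec_mulVec, mulVec_mulVec, mul_nonsing_inv _ (isUnit_iff_ne_zero.2 hW), one_mulVec]
  have hker : (LinearMap.ker f).map (LinearMap.ker K.mulVecLin).subtype =
      LinearMap.ker M.mulVecLin := by
    ext x
    rw [LinearMap.mem_ker, mulVecLin_apply, add_smul_mulVec_eq_zero_iff hN hτ hD hU]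
    constructor
    · rintro ⟨y, hy, rfl⟩
      exact ⟨y.2, hy⟩
    · rintro ⟨h1, h2⟩
      exact ⟨⟨x, h1⟩, h2, rfl⟩
  have h1 := f.finrank_range_add_finrank_ker
  rw [LinearMap.range_eq_top.2 hf, finrank_top, Module.finrank_fintype_fun_eq_card,
    ← Submodule.finrank_map_subtype_eq, hker] at h1
  have h2 := K.mulVecLin.finrank_range_add_finrank_ker
  have h3 := M.mulVecLin.finrank_range_add_finrank_ker
  rw [Matrix.rank, Matrix.rank]
  omega

/-- For finite `z` take `c = z - μ` and `g = 1 / c`. At infinity `g = 0`, and `c = -1` since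
`homValue 1 0` is `-B`. -/
theorem exists_valueAt_eq_smul (μ : ℂ) (z : OnePoint ℂ) (hz : z ≠ μ) :
    ∃ g c : ℂ, c ≠ 0 ∧ ∀ (m n : Type) (K : MatrixPencil m n),
      K.valueAt z = c • K.homValue (1 + μ * g) g := by
  induction z using OnePoint.rec with
  | infty => exact ⟨0, -1, by simp, fun m n K => by rw [valueAt_infty, mul_zero, add_zero]⟩
  | coe z =>
    have hz : z - μ ≠ 0 := sub_ne_zero.2 fun h => hz (congrArg _ h)
    refine ⟨(z - μ)⁻¹, z - μ, hz, fun m n K => ?_⟩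
    rw [valueAt_coe, homValue, homValue, smul_sub, smul_smul, smul_smul, mul_inv_cancel₀ hz,
      mul_add,
      mul_left_comm, mul_inv_cancel₀ hz]
    congr 2
    ring

theorem valueAt_eq_smul (z : OnePoint ℂ) : ∃ a b c : ℂ, c ≠ 0 ∧ (a ≠ 0 ∨ b ≠ 0) ∧
    ∀ (m n : Type) (K : MatrixPencil m n), K.valueAt z = c • K.homValue a b := by
  induction z using OnePoint.rec with
  | infty => exact ⟨1, 0, -1, by simp, by simp, fun m n K => valueAt_infty K⟩
  | coe z => exact ⟨z, 1, 1, by simp, by simp, fun m n K => by rw [valueAt_coe, one_smul]⟩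

theorem valueAt_perturb {m n k : Type} [Fintype k] (K : MatrixPencil m n) (U : Matrix m k ℂ)
    (V : Matrix n k ℂ) (D : MatrixPencil k k) (τ : ℂ) (z : OnePoint ℂ) :
    (K.perturb U V D τ).valueAt z = K.valueAt z + τ • (U * D.valueAt z * Vᴴ) := by
  obtain ⟨a, b, c, -, -, h⟩ := valueAt_eq_smul z
  rw [h, h, h, homValue_perturb, smul_add, Matrix.mul_smul, Matrix.smul_mul, smul_comm c τ]

theorem bddAbove_rank {m n : Type} [Fintype n] (K : MatrixPencil m n) :
    BddAbove (Set.range fun z : ℂ => (K.A - z • K.B).rank) :=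
  ⟨Fintype.card n, by rintro _ ⟨z, rfl⟩; exact rank_le_card_width _⟩

theorem nrank_le_card {m n : Type} [Fintype n] (K : MatrixPencil m n) : K.nrank ≤ Fintype.card n :=
  ciSup_le fun _ => rank_le_card_width _

theorem rank_le_nrank {m n : Type} [Fintype n] (K : MatrixPencil m n) (z : ℂ) :
    (K.A - z • K.B).rank ≤ K.nrank :=
  le_ciSup (bddAbove_rank K) z

theorem rank_valueAt_directSum {m n m' n' : Type} [Fintype n] [Fintype n']
     (K : MatrixPencil m n) (L : MatrixPencil m' n') (z : OnePoint ℂ) :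
    ((K.directSum L).valueAt z).rank = (K.valueAt z).rank + (L.valueAt z).rank := by
  obtain ⟨a, b, c, hc, -, h⟩ := valueAt_eq_smul z
  rw [h, h, h, rank_smul_of_ne_zero hc, rank_smul_of_ne_zero hc, rank_smul_of_ne_zero hc,
    homValue_directSum, rank_fromBlocks_diagonal]

section

variable {m n m' n' : Type} [Fintype m] [Fintype n] [DecidableEq m] [DecidableEq n]
  [Fintype m'] [Fintype n'] [DecidableEq m'] [DecidableEq n']

theorem IsRegular.nrank_eq {K : MatrixPencil n n} (h : K.IsRegular) : K.nrank = Fintype.card n := by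
  obtain ⟨z, hz⟩ := h
  exact (nrank_le_card K).antisymm ((rank_of_det_ne_zero hz).ge.trans (rank_le_nrank K z))

theorem IsRegular.isEigenvalue_iff {K : MatrixPencil n n} (h : K.IsRegular) (z : OnePoint ℂ) :
    K.IsEigenvalue z ↔ (K.valueAt z).det = 0 := by
  rw [IsEigenvalue, h.nrank_eq, rank_lt_card_iff]

/-- A regular pencil has finitely many finite eigenvalues. -/
theorem IsRegular.finite_det_eq_zero {K : MatrixPencil n n} (h : K.IsRegular) :
    {z : ℂ | (K.A - z • K.B).det = 0}.Finite := by
  let p : Polynomial ℂ :=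
    (K.A.map Polynomial.C - (Polynomial.X : Polynomial ℂ) • K.B.map Polynomial.C).det
  have hp (z : ℂ) : p.eval z = (K.A - z • K.B).det := by
    rw [← Polynomial.coe_evalRingHom, RingHom.map_det]
    refine congrArg det ?_
    ext i j
    simp [mul_comm (K.B i j)]
  have hp0 : p ≠ 0 := by
    obtain ⟨z, hz⟩ := h
    rintro h0
    rw [← hp, h0, Polynomial.eval_zero] at hz
    exact hz rfl
  refine (p.roots.toFinset.finite_toSet).subset fun z hz => ?_
  simpa [hp0, hp] using hz

theorem StrictlyEquivalent.rank_valueAt {K : MatrixPencil m n} {L : MatrixPencil m' n'}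
    (h : K.StrictlyEquivalent L) (z : OnePoint ℂ) : (K.valueAt z).rank = (L.valueAt z).rank := by
  obtain ⟨P, P', Q, Q', h1, h2, h3, h4, h5, h6⟩ := h
  obtain ⟨a, b, c, hc, -, h⟩ := valueAt_eq_smul z
  rw [h, h, rank_smul_of_ne_zero hc, rank_smul_of_ne_zero hc]
  have hL := homValue_conj h5 h6 a b
  have hK : P' * L.homValue a b * Q' = K.homValue a b := by
    rw [← hL, Matrix.mul_assoc, Matrix.mul_assoc, h3, ← Matrix.mul_assoc, ← Matrix.mul_assoc, h2,
      Matrix.one_mul, Matrix.mul_one]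
  apply le_antisymm
  · rw [← hK]
    exact (rank_mul_le_left _ _).trans (rank_mul_le_right _ _)
  · rw [← hL]
    exact (rank_mul_le_left _ _).trans (rank_mul_le_right _ _)

theorem StrictlyEquivalent.card_eq {K : MatrixPencil m n} {L : MatrixPencil m' n'}
    (h : K.StrictlyEquivalent L) : Fintype.card m = Fintype.card m' ∧
      Fintype.card n = Fintype.card n' := by
  obtain ⟨P, P', Q, Q', h1, h2, h3, h4, h5, h6⟩ := h
  have key {a b : Type} [Fintype a] [Fintype b] [DecidableEq a] [DecidableEq b]
      (M : Matrix a b ℂ) (N : Matrix b a ℂ) (h : M * N = 1) : Fintype.card a ≤ Fintype.card b := by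
    rw [← rank_one (R := ℂ) (n := a), ← h]
    exact (rank_mul_le_left _ _).trans (rank_le_card_width _)
  exact ⟨(key _ _ h2).antisymm (key _ _ h1), (key _ _ h3).antisymm (key _ _ h4)⟩

end

/-- Each `L_j` has full row rank at every point, including infinity, so the singular part
contributes no eigenvalue. -/
theorem rank_valueAt_kroneckerSingular {p q : ℕ} (ε : Fin p → ℕ) (η : Fin q → ℕ)
    (z : OnePoint ℂ) : ((kroneckerSingular ε η).valueAt z).rank = ∑ i, ε i + ∑ j, η j := by
  obtain ⟨a, b, c, hc, hab, h⟩ := valueAt_eq_smul z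
  rw [kroneckerSingular, rank_valueAt_directSum, h, h, rank_smul_of_ne_zero hc,
    rank_smul_of_ne_zero hc, rank_blockDiag_kroneckerBlock _ hab, ← blockDiag_transpose,
    homValue_transpose, rank_transpose, rank_blockDiag_kroneckerBlock _ hab]

/-! ### Deflation of the perturbed pencil -/

/-- The row indices of a pencil in Kronecker form with regular part of size `r`. -/
abbrev KroneckerRows (r : ℕ) {k : ℕ} (ε η : Fin k → ℕ) : Type :=
  Fin r ⊕ ((Σ i, Fin (ε i)) ⊕ (Σ j, Fin (η j + 1)))

/-- The column indices of a pencil in Kronecker form with regular part of size `r`. -/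
abbrev KroneckerCols (r : ℕ) {k : ℕ} (ε η : Fin k → ℕ) : Type :=
  Fin r ⊕ ((Σ i, Fin (ε i + 1)) ⊕ (Σ j, Fin (η j)))

/-- A basis of the right null space coming from the singular part at `(a, b)`. -/
def singularRightNull (r : ℕ) {k : ℕ} (ε η : Fin k → ℕ) (a b : ℂ) :
    Matrix (KroneckerCols r ε η) (Fin k) ℂ :=
  fromRows 0 (fromRows (kroneckerNull ε a b) 0)

/-- A basis of the left null space coming from the singular part at `(a, b)`. -/
def singularLeftNull (r : ℕ) {k : ℕ} (ε η : Fin k → ℕ) (a b : ℂ) :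
    Matrix (Fin k) (KroneckerRows r ε η) ℂ :=
  fromCols 0 (fromCols 0 (kroneckerNull η a b)ᵀ)

section

variable {r k : ℕ} (R : MatrixPencil (Fin r) (Fin r)) (ε η : Fin k → ℕ)

theorem homValue_mul_singularRightNull (a b : ℂ) :
    (R.directSum (kroneckerSingular ε η)).homValue a b *
      singularRightNull r ε η a b = 0 := by
  rw [homValue_directSum, kroneckerSingular, homValue_directSum, singularRightNull,
    fromBlocks_mul_fromRows, fromBlocks_mul_fromRows, blockDiag_kroneckerBlock_mul_kroneckerNull]
  simp

theorem singularLeftNull_mul_homValue (a b : ℂ) :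
    singularLeftNull r ε η a b *
      (R.directSum (kroneckerSingular ε η)).homValue a b = 0 := by
  rw [homValue_directSum, kroneckerSingular, homValue_directSum, singularLeftNull,
    fromCols_mul_fromBlocks, fromCols_mul_fromBlocks, ← blockDiag_transpose, homValue_transpose,
    ← transpose_mul, blockDiag_kroneckerBlock_mul_kroneckerNull]
  simp

theorem exists_mul_singularRightNull_eq_one {a b : ℂ} (h : a ≠ 0 ∨ b ≠ 0) :
    ∃ M : Matrix (Fin k) (KroneckerCols r ε η) ℂ, M * singularRightNull r ε η a b = 1 := by
  obtain ⟨M, hM⟩ := exists_mul_kroneckerNull_eq_one ε h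
  refine ⟨fromCols 0 (fromCols M 0), ?_⟩
  rw [singularRightNull, fromCols_mul_fromRows, fromCols_mul_fromRows, hM]
  simp

theorem exists_singularLeftNull_mul_eq_one {a b : ℂ} (h : a ≠ 0 ∨ b ≠ 0) :
    ∃ M : Matrix (KroneckerRows r ε η) (Fin k) ℂ, singularLeftNull r ε η a b * M = 1 := by
  obtain ⟨M, hM⟩ := exists_mul_kroneckerNull_eq_one η h
  refine ⟨fromRows 0 (fromRows 0 Mᵀ), ?_⟩
  rw [singularLeftNull, fromCols_mul_fromRows, fromCols_mul_fromRows, ← transpose_mul, hM]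
  simp

/-- The regular part is a direct summand of every perturbation with the given column and row
spaces, by one fixed transformation. -/
theorem exists_blockDiagonalization {R : MatrixPencil (Fin r) (Fin r)} {μ : ℂ}
    (hμ : (R.homValue μ 1).det ≠ 0) {ε η : Fin k → ℕ}
    (U : Matrix (KroneckerRows r ε η) (Fin k) ℂ)
    (W : Matrix (Fin k) (KroneckerCols r ε η) ℂ)
    (hU : ∀ g, (R.homValue (1 + μ * g) g).det = 0 →
      (singularLeftNull r ε η (1 + μ * g) g * U).det ≠ 0)
    (hW : ∀ g, (R.homValue (1 + μ * g) g).det = 0 →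
      (W * singularRightNull r ε η (1 + μ * g) g).det ≠ 0) :
    ∃ (P P' : Matrix (KroneckerRows r ε η) (KroneckerRows r ε η) ℂ)
      (Q Q' : Matrix (KroneckerCols r ε η) (KroneckerCols r ε η) ℂ),
      P * P' = 1 ∧ P' * P = 1 ∧ Q * Q' = 1 ∧ Q' * Q = 1 ∧ ∀ C : Matrix (Fin k) (Fin k) ℂ,
        (∃ N, P * ((R.directSum (kroneckerSingular ε η)).A + U * C * W) * Q =
          fromBlocks R.A 0 0 N) ∧
        ∃ N, P * ((R.directSum (kroneckerSingular ε η)).B + U * C * W) * Q =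
          fromBlocks R.B 0 0 N := by
  obtain ⟨U₁, U₂, U₃, rfl⟩ : ∃ U₁ U₂ U₃, U = fromRows U₁ (fromRows U₂ U₃) :=
    ⟨_, _, _, by rw [fromRows_toRows, fromRows_toRows]⟩
  obtain ⟨W₁, W₂, W₃, rfl⟩ : ∃ W₁ W₂ W₃, W = fromCols W₁ (fromCols W₂ W₃) :=
    ⟨_, _, _, by rw [fromCols_toCols, fromCols_toCols]⟩
  obtain ⟨X, Y, hXA, hXB, hX⟩ := exists_deflation ε hμ W₁ W₂ fun g hg => by
    simpa [singularRightNull, fromCols_mul_fromRows] using hW g hg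
  -- The left deflating space comes from the transposed pencil, in which the `L_j^T` blocks become
  -- `L_j` blocks.
  obtain ⟨Z, V, hZA, hZB, hZ⟩ := exists_deflation η (R := R.transpose) (μ := μ)
    (by rwa [homValue_transpose, det_transpose]) U₁ᵀ U₃ᵀ fun g hg => by
      rw [homValue_transpose, det_transpose] at hg
      rw [← det_transpose, transpose_mul, transpose_transpose]
      simpa [singularLeftNull, fromCols_mul_fromRows] using hU g hg
  have hZ' : U₁ + Zᵀ * U₃ = 0 := by
    rw [← transpose_inj, transpose_add, transpose_mul, transpose_transpose, hZ, transpose_zero]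
  -- The right tilt uses only the `L_j` blocks and the left one only the `L_j^T` blocks, so the two
  -- do not interact.
  have hZY : fromCols (0 : Matrix (Fin r) (Σ i, Fin (ε i)) ℂ) Zᵀ *
      fromRows Y (0 : Matrix (Σ j, Fin (η j + 1)) (Fin r) ℂ) = 0 := by
    rw [fromCols_mul_fromRows]; simp
  have hVX : fromCols (0 : Matrix (Fin r) (Σ i, Fin (ε i + 1)) ℂ) Vᵀ *
      fromRows X (0 : Matrix (Σ j, Fin (η j)) (Fin r) ℂ) = 0 := by
    rw [fromCols_mul_fromRows]; simp
  have key (R₀ : Matrix (Fin r) (Fin r) ℂ) (L : Matrix (Σ i, Fin (ε i)) (Σ i, Fin (ε i + 1)) ℂ)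
      (L' : Matrix (Σ j, Fin (η j)) (Σ j, Fin (η j + 1)) ℂ) (hL : L * X = Y * R₀)
      (hL' : L' * Z = V * R₀ᵀ) (C : Matrix (Fin k) (Fin k) ℂ) :=
    mul_mul_eq_fromBlocks_diagonal (R := R₀) (M := fromBlocks R₀ 0 0 (fromBlocks L 0 0 L'ᵀ) +
      fromRows U₁ (fromRows U₂ U₃) * C * fromCols W₁ (fromCols W₂ W₃))
      (by
        rw [Matrix.add_mul, Matrix.mul_assoc _ (fromCols _ _), fromCols_mul_fromRows,
          fromCols_mul_fromRows, Matrix.mul_one, Matrix.mul_zero, add_zero, hX, Matrix.mul_zero,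
          add_zero, fromBlocks_mul_fromRows, fromBlocks_mul_fromRows, hL, fromRows_mul,
          fromRows_mul]
        simp)
      (by
        have hL'' : Zᵀ * L'ᵀ = R₀ * Vᵀ := by
          rw [← transpose_mul, hL', transpose_mul, transpose_transpose]
        rw [Matrix.mul_add, ← Matrix.mul_assoc, ← Matrix.mul_assoc, fromCols_mul_fromRows,
          fromCols_mul_fromRows, Matrix.one_mul, Matrix.zero_mul, zero_add, hZ', Matrix.zero_mul,
          Matrix.zero_mul, add_zero, fromCols_mul_fromBlocks, fromCols_mul_fromBlocks, hL'',
          mul_fromCols, mul_fromCols]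
        simp)
      hZY hVX
  refine ⟨_, _, _, _, (fromBlocks_deflation_inverse hZY).1, (fromBlocks_deflation_inverse hZY).2,
    (fromBlocks_deflation_inverse hVX).2, (fromBlocks_deflation_inverse hVX).1,
    fun C => ⟨⟨_, Eq.trans ?_ (key R.A _ _ hXA hZA C)⟩, ⟨_, Eq.trans ?_ (key R.B _ _ hXB hZB C)⟩⟩⟩
  · simp only [kroneckerSingular, directSum, ← blockDiag_transpose]
    rfl
  · simp only [kroneckerSingular, directSum, ← blockDiag_transpose]
    rfl

end

end MatrixPencil

/-! ### Genericity -/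

/-- The exceptional set is the zero set of the product of all these determinants. Each factor takes
the value 1 somewhere, by the one-sided inverses, and the polynomial ring is a domain. -/
theorem holdsGenerically_of_det_ne_zero {n k : ℕ} {σ : Type}
    {P : Matrix (Fin n) (Fin k) ℂ → Matrix (Fin n) (Fin k) ℂ → Prop} (E : Finset σ)
    (N : σ → Matrix (Fin k) (Fin n) ℂ) (T : σ → Matrix (Fin n) (Fin k) ℂ)
    (hN : ∀ e ∈ E, ∃ M : Matrix (Fin n) (Fin k) ℂ, N e * M = 1)
    (hT : ∀ e ∈ E, ∃ M : Matrix (Fin k) (Fin n) ℂ, M * T e = 1)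
    (h : ∀ U V, (∀ e ∈ E, (N e * U).det ≠ 0) → (∀ e ∈ E, (Vᴴ * T e).det ≠ 0) → P U V) :
    HoldsGenerically P := by
  let X : Matrix (Fin n) (Fin k) (MvPolynomial ((Fin n × Fin k) ⊕ (Fin k × Fin n)) ℂ) :=
    Matrix.of fun i j => MvPolynomial.X (Sum.inl (i, j))
  let Y : Matrix (Fin k) (Fin n) (MvPolynomial ((Fin n × Fin k) ⊕ (Fin k × Fin n)) ℂ) :=
    Matrix.of fun i j => MvPolynomial.X (Sum.inr (i, j))
  let N' (e : σ) : Matrix (Fin k) (Fin n) (MvPolynomial ((Fin n × Fin k) ⊕ (Fin k × Fin n)) ℂ) :=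
    (N e).map MvPolynomial.C
  let T' (e : σ) : Matrix (Fin n) (Fin k) (MvPolynomial ((Fin n × Fin k) ⊕ (Fin k × Fin n)) ℂ) :=
    (T e).map MvPolynomial.C
  let p (e : σ) := (N' e * X).det
  let q (e : σ) := (Y * T' e).det
  have hp (e : σ) (U : Matrix (Fin n) (Fin k) ℂ) (W : Matrix (Fin k) (Fin n) ℂ) :
      MvPolynomial.eval (pairEntries U W) (p e) = (N e * U).det := by
    simp only [p]
    rw [RingHom.map_det, RingHom.mapMatrix_apply, Matrix.map_mul]
    refine congrArg det (congrArg₂ _ ?_ ?_) <;>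
    · ext i j
      simp [N', X, pairEntries]
  have hq (e : σ) (U : Matrix (Fin n) (Fin k) ℂ) (W : Matrix (Fin k) (Fin n) ℂ) :
      MvPolynomial.eval (pairEntries U W) (q e) = (W * T e).det := by
    simp only [q]
    rw [RingHom.map_det, RingHom.mapMatrix_apply, Matrix.map_mul]
    refine congrArg det (congrArg₂ _ ?_ ?_) <;>
    · ext i j
      simp [T', Y, pairEntries]
  let f := ∏ e ∈ E, p e * q e
  have hf : f ≠ 0 := by
    refine Finset.prod_ne_zero_iff.2 fun e he => mul_ne_zero (fun h0 => ?_) (fun h0 => ?_)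
    · obtain ⟨M, hM⟩ := hN e he
      have := hp e M 0
      rw [h0, hM, det_one, map_zero] at this
      exact zero_ne_one this
    · obtain ⟨M, hM⟩ := hT e he
      have := hq e 0 M
      rw [h0, hM, det_one, map_zero] at this
      exact zero_ne_one this
  refine ⟨{x | MvPolynomial.eval x f ≠ 0}, ⟨{x | MvPolynomial.eval x f = 0}, ⟨{f}, by simp⟩, ?_,
    fun x hx => by simpa using hx⟩, fun U V hUV => ?_⟩
  · intro h0
    refine hf (MvPolynomial.funext fun x => ?_)
    rw [map_zero]
    exact (Set.eq_univ_iff_forall.1 h0) x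
  · simp only [f, Set.mem_ofPred_eq, map_prod, map_mul, hp, hq, Finset.prod_ne_zero_iff] at hUV
    exact h U V (fun e he => left_ne_zero_of_mul (hUV e he))
      fun e he => right_ne_zero_of_mul (hUV e he)

/-! ### Rank completion at eigenvalues and the complement of the regular part -/

namespace MatrixPencil

theorem exists_fin_strictlyEquivalent {m n : Type} [Fintype m] [Fintype n] [DecidableEq m]
    [DecidableEq n] (K : MatrixPencil m n) {s : ℕ} (hm : Fintype.card m = s)
    (hn : Fintype.card n = s) : ∃ L : MatrixPencil (Fin s) (Fin s), K.StrictlyEquivalent L :=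
  ⟨⟨K.A.submatrix (Fintype.equivFinOfCardEq hm).symm (Fintype.equivFinOfCardEq hn).symm,
    K.B.submatrix (Fintype.equivFinOfCardEq hm).symm (Fintype.equivFinOfCardEq hn).symm⟩,
    .of_equiv _ _ _ _ rfl rfl⟩

section

variable {n r k : ℕ} {K : MatrixPencil (Fin n) (Fin n)} {R : MatrixPencil (Fin r) (Fin r)}

theorem rank_valueAt_eq {p q : ℕ} {ε : Fin p → ℕ} {η : Fin q → ℕ}
    (h : K.StrictlyEquivalent (R.directSum (kroneckerSingular ε η))) (z : OnePoint ℂ) :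
    (K.valueAt z).rank = (R.valueAt z).rank + (∑ i, ε i + ∑ j, η j) := by
  rw [h.rank_valueAt, rank_valueAt_directSum, rank_valueAt_kroneckerSingular]

theorem nrank_eq_of_isRegular {p q : ℕ} {ε : Fin p → ℕ} {η : Fin q → ℕ} (hR : R.IsRegular)
    (h : K.StrictlyEquivalent (R.directSum (kroneckerSingular ε η))) :
    K.nrank = r + (∑ i, ε i + ∑ j, η j) := by
  obtain ⟨μ, hμ⟩ := hR
  apply le_antisymm
  · refine ciSup_le fun z => (rank_valueAt_eq h z).le.trans (Nat.add_le_add_right ?_ _)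
    exact rank_le_width _
  · have h1 := rank_le_nrank K μ
    have h2 := rank_valueAt_eq h μ
    have h3 : (R.valueAt (μ : OnePoint ℂ)).rank = Fintype.card (Fin r) := rank_of_det_ne_zero hμ
    rw [h3, Fintype.card_fin] at h2
    exact h2.ge.trans h1

variable {ε η : Fin k → ℕ} {D : MatrixPencil (Fin k) (Fin k)}

/-- The perturbation `U D V^*` completes the rank of `K` at `z`: suitable null vectors of `K` are
not annihilated. -/
def CompletesRankAt (K : MatrixPencil (Fin n) (Fin n)) (D : MatrixPencil (Fin k) (Fin k))
    (U V : Matrix (Fin n) (Fin k) ℂ) (z : OnePoint ℂ) : Prop :=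
  (D.valueAt z).det ≠ 0 ∧ (∃ N : Matrix (Fin k) (Fin n) ℂ, N * K.valueAt z = 0 ∧ (N * U).det ≠ 0) ∧
    ∃ T : Matrix (Fin n) (Fin k) ℂ, K.valueAt z * T = 0 ∧ (Vᴴ * T).det ≠ 0

section CompletesRankAt

variable {U V : Matrix (Fin n) (Fin k) ℂ} {z : OnePoint ℂ} {τ : ℂ}

theorem CompletesRankAt.rank_valueAt_perturb (h : K.CompletesRankAt D U V z)
    (hτ : τ ≠ 0) : ((K.perturb U V D τ).valueAt z).rank = (K.valueAt z).rank + k := by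
  obtain ⟨hD, ⟨N, hN, hU⟩, T, hT, hV⟩ := h
  rw [valueAt_perturb, rank_add_smul hN hT hτ hD hU hV, Fintype.card_fin]

theorem CompletesRankAt.mem_rightNull_perturb_iff (h : K.CompletesRankAt D U V z)
    (hτ : τ ≠ 0) (x : Fin n → ℂ) :
    x ∈ (K.perturb U V D τ).rightNull z ↔ K.valueAt z *ᵥ x = 0 ∧ Vᴴ *ᵥ x = 0 := by
  obtain ⟨hD, ⟨N, hN, hU⟩, -⟩ := h
  rw [rightNull, LinearMap.mem_ker, mulVecLin_apply, valueAt_perturb,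
    add_smul_mulVec_eq_zero_iff hN hτ hD hU]

theorem CompletesRankAt.mem_leftNull_perturb_iff (h : K.CompletesRankAt D U V z)
    (hτ : τ ≠ 0) (y : Fin n → ℂ) :
    y ∈ (K.perturb U V D τ).leftNull z ↔ (K.valueAt z)ᴴ *ᵥ y = 0 ∧ Uᴴ *ᵥ y = 0 := by
  obtain ⟨hD, -, T, hT, hV⟩ := h
  have key {a : Type} (M : Matrix (Fin n) a ℂ) : Mᴴ *ᵥ y = 0 ↔ star y ᵥ* M = 0 := by
    rw [← star_inj, star_mulVec, conjTranspose_conjTranspose, star_zero]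
  rw [leftNull, LinearMap.mem_ker, mulVecLin_apply, valueAt_perturb, key, key, key,
    vecMul_add_smul_eq_zero_iff hT hτ hD hV]

end CompletesRankAt

/-- The null spaces of the perturbed pencil at an eigenvalue where the rank is completed. -/
theorem eigenvalue_perturb {U V : Matrix (Fin n) (Fin k) ℂ} {μ : ℂ} {z : OnePoint ℂ}
    (hz : K.CompletesRankAt D U V z) (hKz : K.IsEigenvalue z) (hμ : K.CompletesRankAt D U V μ)
    (hKμ : (K.valueAt μ).rank = K.nrank) :
    (∀ τ : ℂ, τ ≠ 0 → (K.perturb U V D τ).IsEigenvalue z) ∧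
      (∀ τ τ' : ℂ, τ ≠ 0 → τ' ≠ 0 →
        (K.perturb U V D τ).rightNull z = (K.perturb U V D τ').rightNull z ∧
        (K.perturb U V D τ).leftNull z = (K.perturb U V D τ').leftNull z) ∧
      ∀ τ : ℂ, τ ≠ 0 → (∀ x ∈ (K.perturb U V D τ).rightNull z, Vᴴ.mulVec x = 0) ∧
        ∀ y ∈ (K.perturb U V D τ).leftNull z, Uᴴ.mulVec y = 0 := by
  refine ⟨fun τ hτ => ?_, fun τ τ' hτ hτ' => ⟨?_, ?_⟩, fun τ hτ => ⟨fun x hx => ?_, fun y hy => ?_⟩⟩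
  · have h1 : (K.valueAt z).rank < K.nrank := hKz
    -- The rank rises by `k` at both `z` and `μ`, so the drop at `z` persists.
    have h2 : ((K.perturb U V D τ).valueAt μ).rank ≤ (K.perturb U V D τ).nrank :=
      rank_le_nrank _ μ
    rw [hμ.rank_valueAt_perturb hτ] at h2
    rw [IsEigenvalue, hz.rank_valueAt_perturb hτ]
    omega
  · ext x
    rw [hz.mem_rightNull_perturb_iff hτ, hz.mem_rightNull_perturb_iff hτ']
  · ext y
    rw [hz.mem_leftNull_perturb_iff hτ, hz.mem_leftNull_perturb_iff hτ']
  · exact ((hz.mem_rightNull_perturb_iff hτ x).1 hx).2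
  · exact ((hz.mem_leftNull_perturb_iff hτ y).1 hy).2

/-- If the rank is completed at all eigenvalues, a complement of the regular part in the perturbed
pencil is regular and has no eigenvalue of the regular part. -/
theorem complement_isRegular {s : ℕ} {U V : Matrix (Fin n) (Fin k) ℂ} {μ : ℂ} (hR : R.IsRegular)
    (hK : K.StrictlyEquivalent (R.directSum (kroneckerSingular ε η)))
    (hn : n = r + (∑ i, ε i + ∑ j, η j) + k)
    (hμ : K.CompletesRankAt D U V μ)
    (hz : ∀ z, K.IsEigenvalue z → K.CompletesRankAt D U V z) {τ : ℂ} (hτ : τ ≠ 0)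
    {N : MatrixPencil (Fin s) (Fin s)}
    (h : (K.perturb U V D τ).StrictlyEquivalent (R.directSum N)) :
    N.IsRegular ∧ ∀ z : OnePoint ℂ, N.IsEigenvalue z → ¬ R.IsEigenvalue z := by
  have hcard := h.card_eq.1
  simp only [Fintype.card_fin, Fintype.card_sum] at hcard
  -- Cancelling the rank of `R` at `z` leaves `N` with rank `∑ ε + ∑ η + k`, which is its size.
  have key (z : OnePoint ℂ) (hz : K.CompletesRankAt D U V z) : (N.valueAt z).det ≠ 0 := by
    intro h0
    have h1 := (rank_lt_card_iff _).2 h0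
    have h2 := h.rank_valueAt z
    rw [rank_valueAt_directSum, hz.rank_valueAt_perturb hτ, rank_valueAt_eq hK] at h2
    rw [Fintype.card_fin] at h1
    omega
  have hN : N.IsRegular := ⟨μ, key μ hμ⟩
  refine ⟨hN, fun z hNz hRz => key z (hz z ?_) ((hN.isEigenvalue_iff z).1 hNz)⟩
  have hRz' : (R.valueAt z).rank < R.nrank := hRz
  rw [hR.nrank_eq, Fintype.card_fin] at hRz'
  rw [IsEigenvalue, rank_valueAt_eq hK, nrank_eq_of_isRegular hR hK]
  omega

/-- The block diagonalising transformation works for every middle factor `C`, hence for `τ • D.A`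
and `τ • D.B` at once. -/
theorem exists_strictlyEquivalent_directSum {U V : Matrix (Fin n) (Fin k) ℂ} {μ : ℂ}
    (hμ : (R.homValue μ 1).det ≠ 0) {P : Matrix (KroneckerRows r ε η) (Fin n) ℂ}
    {P' : Matrix (Fin n) (KroneckerRows r ε η) ℂ} {Q : Matrix (Fin n) (KroneckerCols r ε η) ℂ}
    {Q' : Matrix (KroneckerCols r ε η) (Fin n) ℂ} (h1 : P * P' = 1) (h2 : P' * P = 1)
    (h3 : Q * Q' = 1) (h4 : Q' * Q = 1)
    (hA : P * K.A * Q = (R.directSum (kroneckerSingular ε η)).A)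
    (hB : P * K.B * Q = (R.directSum (kroneckerSingular ε η)).B)
    (hU : ∀ g, (R.homValue (1 + μ * g) g).det = 0 →
      (singularLeftNull r ε η (1 + μ * g) g * P * U).det ≠ 0)
    (hV : ∀ g, (R.homValue (1 + μ * g) g).det = 0 →
      (Vᴴ * (Q * singularRightNull r ε η (1 + μ * g) g)).det ≠ 0) (τ : ℂ) :
    ∃ (s : ℕ) (N : MatrixPencil (Fin s) (Fin s)),
      (K.perturb U V D τ).StrictlyEquivalent (R.directSum N) := by
  obtain ⟨S, S', T, T', k1, k2, k3, k4, hC⟩ := exists_blockDiagonalization hμ (P * U) (Vᴴ * Q)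
    (fun g hg => by rw [← Matrix.mul_assoc]; exact hU g hg)
    (fun g hg => by rw [Matrix.mul_assoc]; exact hV g hg)
  obtain ⟨⟨NA, hNA⟩, -⟩ := hC (τ • D.A)
  obtain ⟨-, NB, hNB⟩ := hC (τ • D.B)
  have e1 : (K.perturb U V D τ).StrictlyEquivalent
      ⟨(R.directSum (kroneckerSingular ε η)).A + P * U * (τ • D.A) * (Vᴴ * Q),
        (R.directSum (kroneckerSingular ε η)).B + P * U * (τ • D.B) * (Vᴴ * Q)⟩ := by
    refine ⟨P, P', Q, Q', h1, h2, h3, h4, ?_, ?_⟩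
    · simp only [perturb, ← hA, Matrix.mul_add, Matrix.add_mul, Matrix.mul_smul, Matrix.smul_mul,
        Matrix.mul_assoc]
    · simp only [perturb, ← hB, Matrix.mul_add, Matrix.add_mul, Matrix.mul_smul, Matrix.smul_mul,
        Matrix.mul_assoc]
  have e2 := e1.trans (M := R.directSum ⟨NA, NB⟩) ⟨S, S', T, T', k1, k2, k3, k4, hNA, hNB⟩
  have hc := e2.card_eq
  rw [Fintype.card_sum (α := Fin r), Fintype.card_sum (α := Fin r)] at hc
  obtain ⟨N, hN⟩ := exists_fin_strictlyEquivalent ⟨NA, NB⟩ rfl (by omega)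
  exact ⟨_, N, e2.trans (.directSum (.refl R) hN)⟩

/-- The null matrices of the Kronecker form are carried back to `K` by `P` and `Q`. -/
theorem completesRankAt_of_homValue {U V : Matrix (Fin n) (Fin k) ℂ}
    {P : Matrix (KroneckerRows r ε η) (Fin n) ℂ} {P' : Matrix (Fin n) (KroneckerRows r ε η) ℂ}
    {Q : Matrix (Fin n) (KroneckerCols r ε η) ℂ} {Q' : Matrix (KroneckerCols r ε η) (Fin n) ℂ}
    (h2 : P' * P = 1) (h3 : Q * Q' = 1)
    (hA : P * K.A * Q = (R.directSum (kroneckerSingular ε η)).A)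
    (hB : P * K.B * Q = (R.directSum (kroneckerSingular ε η)).B) {z : OnePoint ℂ} {a b c : ℂ}
    (hz : K.valueAt z = c • K.homValue a b) (hD : (D.valueAt z).det ≠ 0)
    (hU : (singularLeftNull r ε η a b * P * U).det ≠ 0)
    (hV : (Vᴴ * (Q * singularRightNull r ε η a b)).det ≠ 0) : K.CompletesRankAt D U V z := by
  have hK := homValue_conj hA hB a b
  refine ⟨hD, ⟨_, ?_, hU⟩, _, ?_, hV⟩
  · have := singularLeftNull_mul_homValue R ε η a b
    rw [← hK] at this
    rw [hz, Matrix.mul_smul, ← Matrix.mul_one (_ * _ * K.homValue a b), ← h3, ← Matrix.mul_assoc,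
      Matrix.mul_assoc (singularLeftNull r ε η a b), Matrix.mul_assoc (singularLeftNull r ε η a b),
      this, Matrix.zero_mul, smul_zero]
  · have := homValue_mul_singularRightNull R ε η a b
    rw [← hK] at this
    rw [hz, Matrix.smul_mul, ← Matrix.one_mul (K.homValue a b * _), ← h2, Matrix.mul_assoc P',
      ← Matrix.mul_assoc (K.homValue a b), ← Matrix.mul_assoc P, ← Matrix.mul_assoc P, this,
      Matrix.mul_zero, smul_zero]

end

end MatrixPencil

/-! ### The main theorem -/

open MatrixPencil

theorem mainTheorem1 (n k : ℕ) (K : MatrixPencil (Fin n) (Fin n)) (D : MatrixPencil (Fin k) (Fin k))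
    (hK : K.IsSingular) (hrank : K.nrank + k = n) (hD : D.IsRegular)
    (hKD : ∀ z : OnePoint ℂ, D.IsEigenvalue z → ¬ K.IsEigenvalue z) :
    (∃ (r : ℕ) (R : MatrixPencil (Fin r) (Fin r)), K.IsRegularPart R) ∧
    ∀ (r : ℕ) (R : MatrixPencil (Fin r) (Fin r)), K.IsRegularPart R →
      HoldsGenerically fun (U V : Matrix (Fin n) (Fin k) ℂ) =>
        U.rank = k → V.rank = k →
          (∀ τ : ℂ, τ ≠ 0 → ∃ (s : ℕ) (Rnew : MatrixPencil (Fin s) (Fin s)),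
            (K.perturb U V D τ).StrictlyEquivalent (R.directSum Rnew) ∧
            Rnew.IsRegular ∧
            ∀ z : OnePoint ℂ, Rnew.IsEigenvalue z → ¬ R.IsEigenvalue z) ∧
          (∀ z : OnePoint ℂ, K.IsEigenvalue z →
            (∀ τ : ℂ, τ ≠ 0 → (K.perturb U V D τ).IsEigenvalue z) ∧
            (∀ τ τ' : ℂ, τ ≠ 0 → τ' ≠ 0 →
              (K.perturb U V D τ).rightNull z = (K.perturb U V D τ').rightNull z ∧
              (K.perturb U V D τ).leftNull z = (K.perturb U V D τ').leftNull z) ∧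
            (∀ τ : ℂ, τ ≠ 0 →
              (∀ x ∈ (K.perturb U V D τ).rightNull z, V.conjTranspose.mulVec x = 0) ∧
              (∀ y ∈ (K.perturb U V D τ).leftNull z, U.conjTranspose.mulVec y = 0))) := by
  refine ⟨K.exists_isRegularPart, fun r R ⟨hR, p, q, ε, η, h⟩ => ?_⟩
  have hnr := nrank_eq_of_isRegular hR h
  obtain ⟨hc1, hc2⟩ := h.card_eq
  simp only [Fintype.card_fin, Fintype.card_sum, Fintype.card_sigma, Finset.sum_add_distrib,
    Finset.sum_const, Finset.card_univ, smul_eq_mul, mul_one] at hc1 hc2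
  -- The normal rank is `r + ∑ ε + ∑ η`, and `n` exceeds it by `p` in the column count and by `q` in
  -- the row count.
  obtain rfl : p = k := by omega
  obtain rfl : q = p := by omega
  -- A base point that is an eigenvalue neither of `R` nor of `D`.
  obtain ⟨μ, hμ⟩ := (hR.finite_det_eq_zero.union hD.finite_det_eq_zero).exists_notMem
  have hRμ : (R.homValue μ 1).det ≠ 0 := by
    rw [← valueAt_coe]; exact fun h0 => hμ (Or.inl h0)
  have hDμ : (D.valueAt μ).det ≠ 0 := fun h0 => hμ (Or.inr h0)
  have hfin : {g : ℂ | (R.homValue (1 + μ * g) g).det = 0}.Finite := by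
    simp only [det_homValue_eq_zero_iff hRμ]
    exact Matrix.finite_spectrum _
  have hKμ : (K.valueAt μ).rank = K.nrank := by
    rw [rank_valueAt_eq h, hnr, valueAt_coe, rank_of_det_ne_zero hRμ, Fintype.card_fin]
  obtain ⟨P, P', Q, Q', h1, h2, h3, h4, hA, hB⟩ := id h
  -- Homogeneous coordinates of `μ` and of all eigenvalues of `R`, infinity being the case `g = 0`.
  let E : Finset (ℂ × ℂ) := insert (μ, 1) (hfin.toFinset.image fun g => (1 + μ * g, g))
  have hE : ∀ e ∈ E, e.1 ≠ 0 ∨ e.2 ≠ 0 := by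
    intro e he
    rcases Finset.mem_insert.1 he with rfl | he
    · exact Or.inr one_ne_zero
    · obtain ⟨g, -, rfl⟩ := Finset.mem_image.1 he
      by_cases hg : g = 0
      · exact Or.inl (by simp [hg])
      · exact Or.inr hg
  have hgE (g : ℂ) (hg : (R.homValue (1 + μ * g) g).det = 0) : (1 + μ * g, g) ∈ E :=
    Finset.mem_insert_of_mem (Finset.mem_image.2 ⟨g, hfin.mem_toFinset.2 hg, rfl⟩)
  refine holdsGenerically_of_det_ne_zero E (fun e => singularLeftNull r ε η e.1 e.2 * P)
    (fun e => Q * singularRightNull r ε η e.1 e.2) (fun e he => ?_) (fun e he => ?_)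
    fun U V hU hV _ _ => ?_
  · obtain ⟨M, hM⟩ := exists_singularLeftNull_mul_eq_one (r := r) ε η (hE e he)
    refine ⟨P' * M, ?_⟩
    rw [Matrix.mul_assoc, ← Matrix.mul_assoc P, h1, Matrix.one_mul, hM]
  · obtain ⟨M, hM⟩ := exists_mul_singularRightNull_eq_one (r := r) ε η (hE e he)
    refine ⟨M * Q', ?_⟩
    rw [Matrix.mul_assoc, ← Matrix.mul_assoc Q', h4, Matrix.one_mul, hM]
  have hCμ : K.CompletesRankAt D U V μ :=
    completesRankAt_of_homValue h2 h3 hA hB (a := μ) (b := 1) (c := 1)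
      (by rw [valueAt_coe, one_smul]) hDμ (hU (μ, 1) (Finset.mem_insert_self _ _))
      (hV (μ, 1) (Finset.mem_insert_self _ _))
  have hCz (z : OnePoint ℂ) (hz : K.IsEigenvalue z) : K.CompletesRankAt D U V z := by
    have hzμ : z ≠ μ := fun hzμ => by
      rw [hzμ, IsEigenvalue, hKμ] at hz
      exact lt_irrefl _ hz
    obtain ⟨g, c, hc, hg⟩ := exists_valueAt_eq_smul μ z hzμ
    have hRz : (R.homValue (1 + μ * g) g).det = 0 := by
      rw [← rank_lt_card_iff, ← rank_smul_of_ne_zero hc, ← hg, Fintype.card_fin]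
      rw [IsEigenvalue, rank_valueAt_eq h, hnr] at hz
      omega
    exact completesRankAt_of_homValue h2 h3 hA hB (hg _ _ K)
      (fun h0 => hKD z ((hD.isEigenvalue_iff z).2 h0) hz)
      (hU (1 + μ * g, g) (hgE g hRz)) (hV (1 + μ * g, g) (hgE g hRz))
  refine ⟨fun τ hτ => ?_, fun z hz => eigenvalue_perturb (hCz z hz) hz hCμ hKμ⟩
  obtain ⟨s, N, hN⟩ := exists_strictlyEquivalent_directSum (U := U) (V := V) (D := D) hRμ h1 h2 h3
    h4 hA hB (fun g hg => hU (1 + μ * g, g) (hgE g hg))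
    (fun g hg => hV (1 + μ * g, g) (hgE g hg)) τ
  exact ⟨s, N, hN, complement_isRegular hR h (by omega) hCμ hCz hτ hN⟩
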